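/- **Setting.** Let $\mathbb R_+=[0,\infty)$, $r\in\mathbb R$, $T>0$, $S_0>0$, let $S_T:\Omega\to\mathbb R_+$ and $\mathcal F=\sigma(S_T)$. Let $\mathbb Q$ be a probability measure on $(\Omega,\mathcal F)$ with $e^{-rT}E_{\mathbb Q}[S_T]=S_0$, and let $\mathcal P$ be a set of probability measures on $(\Omega,\mathcal F)$, each equivalent to $\mathbb Q$. The set of payoffs is $\mathcal X=\{g(S_T): g:\mathbb R_+\to\mathbb R_+\text{ measurable},\ E_{\mathbb Q}[g(S_T)]<\infty\}$; the price of $X\in\mathcal X$ is $e^{-rT}E_{\mathbb Q}[X]$. Write $F_X^{\mathbb P}$ for the distribution function of $X$ under $\mathbb P$, $F^{-1}(p)=\inf\{x\in\mathbb R_+:F(x)\ge p\}\in[0,\infty]$ (with $\inf\emptyset=\infty$) for the quantile function of a distribution on $\mathbb R_+$, and $\ell^{\mathbb P}=\frac{d\mathbb P}{d\mathbb Q}$. For a set $\mathbb F$ of functions $\mathbb R_+\to\mathbb R$, $F\preceq_{\mathbb F}G$ means $\int f\,dF\le\int f\,dG$ for all $f\in\mathbb F$ for which both integrals are finite. $\mathbb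 F_{FSD}$ is the set of non-decreasing functions $\mathbb R_+\to\mathbb R$, and $\mathbb F_{SSD}$ the set of those that are also concave. $\mathbb F$ is *composition-consistent* if $f\circ g\in\mathbb F$ whenever $f,g\in\mathbb F$ and $g\ge 0$. A payoff $X$ is *$\mathbb P$-cost-efficient* if it has the least price among all payoffs $Y$ with $F_Y^{\mathbb P}=F_X^{\mathbb P}$. $\mathbb F$ is *cost-consistent* if for all $\mathbb P\in\mathcal P$ and all $\mathbb P$-cost-efficient $X,Y\in\mathcal X$ with $F_X^{\mathbb P}\preceq_{\mathbb F}F_Y^{\mathbb P}$ one has $E_{\mathbb Q}[X]\le E_{\mathbb Q}[Y]$, with strict inequality if $F_X^{\mathbb P}\ne F_Y^{\mathbb P}$. A payoff $X$ solves the *$\mathbb F$-robust cost-efficiency problem for $F_0$* if it has the least price among all payoffs $Y$ with $F_0\preceq_{\mathbb F}F_Y^{\mathbb P}$ for all $\mathbb P\in\mathcal P$, and is one of them. A *family of preferences* $(W_{\mathbb P})_{\mathbb P\in\mathcal P}$ consists of functionals $W_{\mathbb P}:\mathcal X\to\mathbb R$; it is *law invariant* if $F_X^{\mathbb P}=F_Y^{\mathbb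 P}$ implies $W_{\mathbb P}(X)=W_{\mathbb P}(Y)$ for all $\mathbb P\in\mathcal P$, $X,Y\in\mathcal X$. It is *$\mathbb F$-family consistent on $\mathcal Y\subset\mathcal X$ with respect to $\mathbb P^*$* if for every $Y\in\mathcal Y$ with $F_Y^{\mathbb P^*}\preceq_{\mathbb F}F_Y^{\mathbb P}$ for all $\mathbb P\in\mathcal P$ one has $W_{\mathbb P^*}(Y)\le W_{\mathbb P}(Y)$ for all $\mathbb P\in\mathcal P$. For a functional $V$ on $\mathcal X$ (real-valued, or an expected utility, which may be infinite or undefined) let $\mathcal Y_V^{x_0}=\{X\in\mathcal X: V(X)\in\mathbb R,\ e^{-rT}E_{\mathbb Q}[X]\le x_0\}$, and $\mathcal Y^{x_0}_{(V_{\mathbb P})_{\mathbb P\in\mathcal P}}=\bigcap_{\mathbb P\in\mathcal P}\mathcal Y^{x_0}_{V_{\mathbb P}}$. Uniqueness of a solution means $\mathbb P^*$-a.s. uniqueness. **Theorem 5.** Let $\mathbb F_{SSD}\subset\mathbb F\subset\mathbb F_{FSD}$, and let $\mathbb F$ be composition-consistent and cost-consistent. Let $\mathbb P^*\in\mathcal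 P$, with $\ell^*=\ell^{\mathbb P^*}$, be a least favorable measure with respect to $\mathbb F$, i.e. $F_{\ell^*}^{\mathbb P^*}\preceq_{\mathbb F}F_{\ell^*}^{\mathbb P}$ for all $\mathbb P\in\mathcal P$. Assume that $F_{\ell^*}^{\mathbb P^*}$ is continuous and that $1/\ell^*$ has finite variance under $\mathbb P^*$. Let $X^*\in\mathcal X$, $x_0=e^{-rT}E_{\mathbb Q}[X^*]$, let $c>0$ with $F_{X^*}^{\mathbb P^*}(c)>0$, let $\xi^*=e^{-rT}/\ell^*$, and define $$u(x)=\int_c^x\big[F_{\xi^*}^{\mathbb P^*}\big]^{-1}\big(1-F_{X^*}^{\mathbb P^*}(y)\big)\,dy\in[-\infty,\infty),\qquad x\in\mathbb R_+.$$ Assume $E_{\mathbb P}[u(X^*)]<\infty$ for all $\mathbb P\in\mathcal P$, and one of the following: (a) $\mathbb F=\mathbb F_{FSD}$; (b) $X^*=f(\ell^*)$ $\mathbb P^*$-a.s. for some $f\in\mathbb F$, and $[F_{X^*}^{\mathbb P^*}]^{-1}\circ F_{\ell^*}^{\mathbb P^*}\in\mathbb F$, in the sense that some $g\in\mathbb F$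 with $g\ge0$ coincides with this composition at all $x$ with $0<F_{\ell^*}^{\mathbb P^*}(x)<1$. Then the following are equivalent: i) $X^*$ is $\mathbb P^*$-cost-efficient. ii) $X^*=[F_{X^*}^{\mathbb P^*}]^{-1}\big(F_{\ell^*}^{\mathbb P^*}(\ell^*)\big)$, $\mathbb P^*$-a.s. iii) $X^*$ is $\mathbb P^*$-a.s. non-decreasing in $\ell^*$: there is a set $A$ of full $\mathbb P^*$-measure such that $\ell^*(\omega)\le\ell^*(\omega')$ implies $X^*(\omega)\le X^*(\omega')$ for $\omega,\omega'\in A$. iv) $X^*$ solves the $\mathbb F$-robust cost-efficiency problem for $F_{X^*}^{\mathbb P^*}$. v) $X^*$ solves $\max_{X\in\mathcal Y^{x_0}_{E_{\mathbb P^*}[u(\cdot)]}}E_{\mathbb P^*}[u(X)]$. vi) $X^*$ solves $\max_{X\in\mathcal Y^{x_0}_{(E_{\mathbb P}[u(\cdot)])_{\mathbb P\in\mathcal P}}}\inf_{\mathbb P\in\mathcal P}E_{\mathbb P}[u(X)]$, and the solution is unique if (a) holds. vii) There is a family of preferences $(W_{\mathbb P})_{\mathbb P\in\mathcal P}$ that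 is $\mathbb F$-family consistent on $\mathcal Y^{x_0}_{(W_{\mathbb P})_{\mathbb P\in\mathcal P}}$ with respect to $\mathbb P^*$ such that $X^*\in\mathcal Y^{x_0}_{(W_{\mathbb P})_{\mathbb P\in\mathcal P}}$ and $X^*$ solves $\max_{X\in\mathcal Y^{x_0}_{W_{\mathbb P^*}}}W_{\mathbb P^*}(X)$; and, if (a) holds, the solution is unique and the family is law invariant. viii) There is a family of preferences $(W_{\mathbb P})_{\mathbb P\in\mathcal P}$ that is $\mathbb F$-family consistent on $\mathcal Y^{x_0}_{(W_{\mathbb P})_{\mathbb P\in\mathcal P}}$ with respect to $\mathbb P^*$ such that $X^*$ solves $\max_{X\in\mathcal Y^{x_0}_{(W_{\mathbb P})_{\mathbb P\in\mathcal P}}}\inf_{\mathbb P\in\mathcal P}W_{\mathbb P}(X)$; and, if (a) holds, the solution is unique and the family is law invariant. -/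

import Mathlib

open MeasureTheory
open scoped NNReal ENNReal

noncomputable section

namespace RobustCE

/-! ### Distributions on `[0, ∞)`

A distribution with support in `[0, ∞)` is represented by the corresponding Borel measure
on `ℝ≥0`; its distribution function is `distFun`. -/

/-- The distribution (law) of the nonnegative random variable `X` under `P`. -/
def law {Ω : Type*} [MeasurableSpace Ω] (P : Measure Ω) (X : Ω → ℝ≥0) : Measure ℝ≥0 :=
  P.map X

/-- The cumulative distribution function of a distribution on `[0, ∞)`, as a function on `ℝ`. -/
def distFun (μ : Measure ℝ≥0) (x : ℝ) : ℝ :=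
  ProbabilityTheory.cdf (μ.map (fun y : ℝ≥0 => (y : ℝ))) x

/-- The quantile function `p ↦ inf {x ∈ [0, ∞) : F(x) ≥ p}`, with `inf ∅ = ∞`. -/
def quantile (μ : Measure ℝ≥0) (p : ℝ) : ℝ≥0∞ :=
  ⨅ (x : ℝ≥0) (_ : p ≤ distFun μ x), (x : ℝ≥0∞)

/-- `μ ≼_𝔽 ν`: integral stochastic ordering with respect to `𝔽`; only those `f ∈ 𝔽` are tested
for which both expectations are finite. -/
def IntegralOrder (𝔽 : Set (ℝ≥0 → ℝ)) (μ ν : Measure ℝ≥0) : Prop :=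
  ∀ f ∈ 𝔽, Integrable f μ → Integrable f ν → ∫ x, f x ∂μ ≤ ∫ x, f x ∂ν

/-- All non-decreasing functions `[0, ∞) → ℝ`. -/
def FSD : Set (ℝ≥0 → ℝ) := {f | Monotone f}

/-- All non-decreasing concave functions `[0, ∞) → ℝ`. -/
def SSD : Set (ℝ≥0 → ℝ) := {f | Monotone f ∧ ConcaveOn ℝ≥0 Set.univ f}

/-- `f ∘ g ∈ 𝔽` for all `f, g ∈ 𝔽` for which the composition makes sense, that is, for which
`g` takes values in `[0, ∞)`. -/
def CompositionConsistent (𝔽 : Set (ℝ≥0 → ℝ)) : Prop :=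
  ∀ f ∈ 𝔽, ∀ g : ℝ≥0 → ℝ≥0, (fun x => (g x : ℝ)) ∈ 𝔽 → (fun x => f (g x)) ∈ 𝔽

/-! ### The market -/

/-- A static market with a bank account and one risky asset, under model ambiguity. -/
structure Market (Ω : Type*) [mΩ : MeasurableSpace Ω] where
  /-- interest rate -/
  r : ℝ
  /-- planning horizon -/
  T : ℝ
  T_pos : 0 < T
  /-- current value of the risky asset -/
  S₀ : ℝ
  S₀_pos : 0 < S₀
  /-- value of the risky asset at maturity -/
  S : Ω → ℝ≥0
  /-- the `σ`-algebra of `Ω` is the one generated by `S` -/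
  sigma_eq : mΩ = MeasurableSpace.comap S inferInstance
  /-- pricing measure -/
  Q : Measure Ω
  isProb_Q : IsProbabilityMeasure Q
  integrable_S : Integrable (fun ω => (S ω : ℝ)) Q
  martingale : Real.exp (-(r * T)) * ∫ ω, (S ω : ℝ) ∂Q = S₀
  /-- the set `𝒫` of plausible real-world measures -/
  models : Set (Measure Ω)
  isProb : ∀ P ∈ models, IsProbabilityMeasure P
  /-- all of them are equivalent to `Q` (hence to each other) -/
  equiv : ∀ P ∈ models, P ≪ Q ∧ Q ≪ P

namespace Market

variable {Ω : Type*} [MeasurableSpace Ω] (M : Market Ω)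

/-- The set `𝒳` of payoffs. -/
def payoffs : Set (Ω → ℝ≥0) :=
  {X | (∃ g : ℝ≥0 → ℝ≥0, Measurable g ∧ X = fun ω => g (M.S ω)) ∧
    Integrable (fun ω => (X ω : ℝ)) M.Q}

/-- The price `e^{-rT} E_Q[X]`. -/
def price (X : Ω → ℝ≥0) : ℝ :=
  Real.exp (-(M.r * M.T)) * ∫ ω, (X ω : ℝ) ∂M.Q

/-- The likelihood ratio `ℓ^P = dP/dQ`. -/
def lik (P : Measure Ω) (ω : Ω) : ℝ≥0 := (P.rnDeriv M.Q ω).toNNReal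

/-- The state price `ξ^P = e^{-rT} / ℓ^P`. -/
def statePrice (P : Measure Ω) (ω : Ω) : ℝ≥0 :=
  Real.toNNReal (Real.exp (-(M.r * M.T))) / M.lik P ω

/-! ### Cost-efficiency -/

/-- Admissible payoffs of the standard cost-efficiency problem for the distribution `F₀`. -/
def standardAdmissible (P : Measure Ω) (F₀ : Measure ℝ≥0) : Set (Ω → ℝ≥0) :=
  {X | X ∈ M.payoffs ∧ law P X = F₀}

/-- Admissible payoffs of the `𝔽`-robust cost-efficiency problem for the distribution `F₀`. -/
def robustAdmissible (𝔽 : Set (ℝ≥0 → ℝ)) (F₀ : Measure ℝ≥0) : Set (Ω → ℝ≥0) :=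
  {X | X ∈ M.payoffs ∧ ∀ P ∈ M.models, IntegralOrder 𝔽 F₀ (law P X)}

/-- `X` is a cheapest element of `A`. -/
def IsCheapest (A : Set (Ω → ℝ≥0)) (X : Ω → ℝ≥0) : Prop :=
  X ∈ A ∧ ∀ Y ∈ A, M.price X ≤ M.price Y

/-- `X` is `P`-cost-efficient. -/
def CostEfficient (P : Measure Ω) (X : Ω → ℝ≥0) : Prop :=
  M.IsCheapest (M.standardAdmissible P (law P X)) X

/-- `X` solves the `𝔽`-robust cost-efficiency problem for `F₀`. -/
def RobustCostEfficient (𝔽 : Set (ℝ≥0 → ℝ)) (F₀ : Measure ℝ≥0) (X : Ω → ℝ≥0) : Prop :=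
  M.IsCheapest (M.robustAdmissible 𝔽 F₀) X

/-- Cost-consistency of `𝔽`. -/
def CostConsistent (𝔽 : Set (ℝ≥0 → ℝ)) : Prop :=
  ∀ X ∈ M.payoffs, ∀ Y ∈ M.payoffs, ∀ P ∈ M.models,
    M.CostEfficient P X → M.CostEfficient P Y → IntegralOrder 𝔽 (law P X) (law P Y) →
      ∫ ω, (X ω : ℝ) ∂M.Q ≤ ∫ ω, (Y ω : ℝ) ∂M.Q ∧
      (law P X ≠ law P Y → ∫ ω, (X ω : ℝ) ∂M.Q < ∫ ω, (Y ω : ℝ) ∂M.Q)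

/-- `Pst` is a least favorable measure with respect to `𝔽`. -/
def LeastFavorable (𝔽 : Set (ℝ≥0 → ℝ)) (Pst : Measure Ω) : Prop :=
  Pst ∈ M.models ∧ ∀ P ∈ M.models, IntegralOrder 𝔽 (law Pst (M.lik Pst)) (law P (M.lik Pst))

/-- The likelihood ratio of `P` has a continuous distribution function under `P`, and its
reciprocal has finite variance under `P`. -/
def RegularLikelihood (P : Measure Ω) : Prop :=
  Continuous (distFun (law P (M.lik P))) ∧ MemLp (fun ω => 1 / (M.lik P ω : ℝ)) 2 P

/-- `X` is `P`-almost surely non-decreasing in `ℓ^P`. -/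
def NondecreasingInLik (P : Measure Ω) (X : Ω → ℝ≥0) : Prop :=
  ∃ A : Set Ω, (∀ᵐ ω ∂P, ω ∈ A) ∧
    ∀ ω ∈ A, ∀ ω' ∈ A, M.lik P ω ≤ M.lik P ω' → X ω ≤ X ω'

/-! ### Preferences and portfolio choice

Functionals on payoffs are allowed to be extended-real-valued here, because an expected utility
may fail to be finite. -/

/-- `𝒴^{x₀}_V`: payoffs with real `V`-value whose price is at most `x₀`. -/
def budget (V : (Ω → ℝ≥0) → EReal) (x₀ : ℝ) : Set (Ω → ℝ≥0) :=
  {X | X ∈ M.payoffs ∧ V X ≠ ⊥ ∧ V X ≠ ⊤ ∧ M.price X ≤ x₀}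

/-- `𝒴^{x₀}_{(V_P)}`: the intersection of the budget sets of all `V_P`, `P ∈ 𝒫`. -/
def robustBudget (V : Measure Ω → (Ω → ℝ≥0) → EReal) (x₀ : ℝ) : Set (Ω → ℝ≥0) :=
  {X | ∀ P ∈ M.models, X ∈ M.budget (V P) x₀}

/-- The worst-case value `inf_{P ∈ 𝒫} V_P(X)`. -/
def worstCase (V : Measure Ω → (Ω → ℝ≥0) → EReal) (X : Ω → ℝ≥0) : EReal :=
  ⨅ P ∈ M.models, V P X

/-- The family is law invariant. -/
def LawInvariant (V : Measure Ω → (Ω → ℝ≥0) → EReal) : Prop :=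
  ∀ P ∈ M.models, ∀ X ∈ M.payoffs, ∀ Y ∈ M.payoffs, law P X = law P Y → V P X = V P Y

/-- The family is `𝔽`-family consistent on `𝒴` with respect to `Pst`. -/
def FamilyConsistent (𝔽 : Set (ℝ≥0 → ℝ)) (𝒴 : Set (Ω → ℝ≥0)) (Pst : Measure Ω)
    (V : Measure Ω → (Ω → ℝ≥0) → EReal) : Prop :=
  ∀ Y ∈ 𝒴, (∀ P ∈ M.models, IntegralOrder 𝔽 (law Pst Y) (law P Y)) →
    ∀ P ∈ M.models, V Pst Y ≤ V P Y

/-- The function `u(x) = ∫_c^x F_ξ⁻¹(1 - F_X(y)) dy`, `x ∈ [0, ∞)`, where `ξ` is the state price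
of `P`, and the distributions are under `P`. The integrand is nonnegative and may be infinite,
so that `u` may take the value `-∞` to the left of `c`. -/
def utility (P : Measure Ω) (X : Ω → ℝ≥0) (c x : ℝ≥0) : EReal :=
  if c ≤ x then
    ((∫⁻ y in Set.Icc (c : ℝ) x,
      quantile (law P (M.statePrice P)) (1 - distFun (law P X) y) : ℝ≥0∞) : EReal)
  else
    -((∫⁻ y in Set.Icc (x : ℝ) c,
      quantile (law P (M.statePrice P)) (1 - distFun (law P X) y) : ℝ≥0∞) : EReal)

end Market

/-- The expected utility `E_P[u(X)] = E_P[u(X)⁺] - E_P[u(X)⁻]`; it is a real number exactly if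
both terms are finite (`∞ - ∞ = -∞` in `EReal`). -/
def expectedUtility {Ω : Type*} [MeasurableSpace Ω] (u : ℝ≥0 → EReal) (P : Measure Ω)
    (X : Ω → ℝ≥0) : EReal :=
  ((∫⁻ ω, (u (X ω)).toENNReal ∂P : ℝ≥0∞) : EReal) -
    ((∫⁻ ω, (-u (X ω)).toENNReal ∂P : ℝ≥0∞) : EReal)

/-- `X` solves the problem of maximizing `V` over `𝒴`. -/
def IsSolution {Ω : Type*} (𝒴 : Set (Ω → ℝ≥0)) (V : (Ω → ℝ≥0) → EReal) (X : Ω → ℝ≥0) : Prop :=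
  X ∈ 𝒴 ∧ ∀ Y ∈ 𝒴, V Y ≤ V X

/-- Every solution of the problem of maximizing `V` over `𝒴` is `P`-a.s. equal to `X`. -/
def OnlySolution {Ω : Type*} [MeasurableSpace Ω] (P : Measure Ω) (𝒴 : Set (Ω → ℝ≥0))
    (V : (Ω → ℝ≥0) → EReal) (X : Ω → ℝ≥0) : Prop :=
  ∀ Y, IsSolution 𝒴 V Y → Y =ᵐ[P] X

/-- A family of real-valued functionals on payoffs, viewed as extended-real-valued. -/
def ofReal {Ω : Type*} [MeasurableSpace Ω] (W : Measure Ω → (Ω → ℝ≥0) → ℝ) :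
    Measure Ω → (Ω → ℝ≥0) → EReal :=
  fun P X => (W P X : EReal)

/-- `X = f(ℓ^P)` `P`-a.s. for some `f ∈ 𝔽`, and `F_X⁻¹ ∘ F_ℓ ∈ 𝔽`. The values of `F_X⁻¹` at the
levels `0` and `1` depend on conventions; therefore the composition is only prescribed where
`F_ℓ` lies in `(0, 1)`, and some extension to a function `[0, ∞) → [0, ∞)` has to be in `𝔽`. -/
def Market.Compatible {Ω : Type*} [MeasurableSpace Ω] (M : Market Ω) (𝔽 : Set (ℝ≥0 → ℝ))
    (P : Measure Ω) (X : Ω → ℝ≥0) : Prop :=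
  (∃ f ∈ 𝔽, ∀ᵐ ω ∂P, (X ω : ℝ) = f (M.lik P ω)) ∧
  ∃ g : ℝ≥0 → ℝ≥0, (fun x => (g x : ℝ)) ∈ 𝔽 ∧
    ∀ x : ℝ≥0, 0 < distFun (law P (M.lik P)) x → distFun (law P (M.lik P)) x < 1 →
      (g x : ℝ≥0∞) = quantile (law P X) (distFun (law P (M.lik P)) x)

end RobustCE

end

/-
The efficient payoff with the `P`-distribution of `X` is `E = F_X⁻¹(F_ℓ(ℓ))`, and `u` is built so
that its marginal utility at `E` is the state price `ξ`. As `u` is concave, its graph lies below the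
tangent of slope `ξ` at `E`: pointwise, `u(y) + ξ E ≤ u(E) + ξ y`. Here equality forces `y = E`
almost surely, because `ξ` has no atoms. The integral of this one inequality says that `E` maximizes
expected utility among the payoffs that are not more expensive, that a payoff which dominates `E` in
the second-order sense is not cheaper, and that `E` is the only optimizer in both problems.
Under a least favorable measure the order between the laws of `ℓ` passes to monotone functions of
`ℓ`, in particular to `E`. Hence the worst case over all measures is attained at `P`, and the robust
problems have the same solution.
-/

namespace RobustCE

/-! ### Distribution functions, quantile functions and monotone transport -/

section Distributions

variable {μ ν : Measure ℝ≥0} {Ω : Type*} [MeasurableSpace Ω] {P : Measure Ω} {L X Y : Ω → ℝ≥0}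

theorem isProbabilityMeasure_law [IsProbabilityMeasure P] (hX : Measurable X) :
    IsProbabilityMeasure (law P X) :=
  Measure.isProbabilityMeasure_map hX.aemeasurable

theorem law_congr (h : X =ᵐ[P] Y) : law P X = law P Y :=
  Measure.map_congr h

theorem lintegral_law (hX : Measurable X) {f : ℝ≥0 → ℝ≥0∞} (hf : Measurable f) :
    ∫⁻ x, f x ∂law P X = ∫⁻ ω, f (X ω) ∂P :=
  lintegral_map hf hX

theorem lintegral_comp_eq_of_law_eq (hX : Measurable X) (hY : Measurable Y)
    (h : law P X = law P Y) {f : ℝ≥0 → ℝ≥0∞} (hf : Measurable f) :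
    ∫⁻ ω, f (X ω) ∂P = ∫⁻ ω, f (Y ω) ∂P := by
  rw [← lintegral_law hX hf, ← lintegral_law hY hf, h]

theorem ae_eq_of_ae_le_of_law_eq [IsFiniteMeasure P] (hX : Measurable X) (hY : Measurable Y)
    (hle : X ≤ᵐ[P] Y) (h : law P X = law P Y) : X =ᵐ[P] Y := by
  -- A bounded strictly increasing function of `X` and `Y` has the same finite integral.
  let φ : ℝ≥0 → ℝ≥0∞ := fun x => ENNReal.orderIsoIicOneBirational x
  have hφ : StrictMono φ := fun x y hxy =>
    ENNReal.orderIsoIicOneBirational.strictMono (ENNReal.coe_lt_coe.2 hxy)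
  have hfin : ∫⁻ ω, φ (X ω) ∂P ≠ ⊤ :=
    ((lintegral_mono fun ω => (ENNReal.orderIsoIicOneBirational (X ω)).2).trans_lt
      (by simp [measure_lt_top])).ne
  have heq : (fun ω => φ (X ω)) =ᵐ[P] fun ω => φ (Y ω) :=
    ae_eq_of_ae_le_of_lintegral_le (hle.mono fun ω hω => hφ.monotone hω) hfin
      (hφ.monotone.measurable.comp hY).aemeasurable
      (lintegral_comp_eq_of_law_eq hX hY h hφ.monotone.measurable).ge
  exact heq.mono fun ω hω => hφ.injective hω

theorem distFun_mono (μ : Measure ℝ≥0) : Monotone (distFun μ) :=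
  ProbabilityTheory.monotone_cdf _

theorem distFun_nonneg (μ : Measure ℝ≥0) (x : ℝ) : 0 ≤ distFun μ x :=
  ProbabilityTheory.cdf_nonneg _ _

theorem distFun_le_one (μ : Measure ℝ≥0) (x : ℝ) : distFun μ x ≤ 1 :=
  ProbabilityTheory.cdf_le_one _ _

theorem ofReal_distFun (μ : Measure ℝ≥0) [IsProbabilityMeasure μ] (x : ℝ) :
    ENNReal.ofReal (distFun μ x) = μ {y | (y : ℝ) ≤ x} := by
  have : IsProbabilityMeasure (μ.map ((↑) : ℝ≥0 → ℝ)) :=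
    Measure.isProbabilityMeasure_map (by fun_prop)
  rw [distFun, ProbabilityTheory.ofReal_cdf, Measure.map_apply (by fun_prop) measurableSet_Iic]
  rfl

theorem ofReal_distFun_law [IsProbabilityMeasure P] (hX : Measurable X) (x : ℝ) :
    ENNReal.ofReal (distFun (law P X) x) = P {ω | (X ω : ℝ) ≤ x} := by
  have := isProbabilityMeasure_law (P := P) hX
  rw [ofReal_distFun, law, Measure.map_apply hX (measurableSet_le (by fun_prop) (by fun_prop))]
  rfl

theorem nullSingletonClass_of_continuous_distFun [IsProbabilityMeasure μ]
    (hμ : Continuous (distFun μ)) : NullSingletonClass μ := by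
  have : IsProbabilityMeasure (μ.map ((↑) : ℝ≥0 → ℝ)) :=
    Measure.isProbabilityMeasure_map (by fun_prop)
  refine ⟨fun a => ?_⟩
  have hpre : ((↑) : ℝ≥0 → ℝ) ⁻¹' {(a : ℝ)} = {a} := by ext y; simp
  have hlim : Function.leftLim (ProbabilityTheory.cdf (μ.map ((↑) : ℝ≥0 → ℝ))) a
      = ProbabilityTheory.cdf (μ.map ((↑) : ℝ≥0 → ℝ)) a :=
    hμ.continuousAt.continuousWithinAt.leftLim_eq
  rw [← hpre, ← Measure.map_apply (by fun_prop) (measurableSet_singleton _),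
    ← ProbabilityTheory.measure_cdf (μ.map ((↑) : ℝ≥0 → ℝ)),
    StieltjesFunction.measure_singleton, hlim, sub_self, ENNReal.ofReal_zero]

theorem le_distFun_of_forall_gt {p x : ℝ} (h : ∀ y, x < y → p ≤ distFun μ y) :
    p ≤ distFun μ x := by
  rw [distFun, ← StieltjesFunction.iInf_Ioi_eq]
  exact le_ciInf fun y => h y y.2

theorem quantile_le_iff {p : ℝ} {x : ℝ≥0} : quantile μ p ≤ x ↔ p ≤ distFun μ x := by
  refine ⟨fun h => le_distFun_of_forall_gt fun r hr => ?_, fun h => iInf₂_le x h⟩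
  lift r to ℝ≥0 using x.2.trans hr.le
  have hlt : quantile μ p < r := h.trans_lt (by exact_mod_cast hr)
  simp only [quantile, iInf_lt_iff] at hlt
  obtain ⟨y, hy, hyr⟩ := hlt
  exact hy.trans (distFun_mono μ (by exact_mod_cast hyr.le))

theorem quantile_mono (μ : Measure ℝ≥0) : Monotone (quantile μ) := fun _ _ hpq =>
  le_iInf₂ fun x hx => iInf₂_le x (hpq.trans hx)

theorem quantile_ne_top {p : ℝ} (hp : p < 1) : quantile μ p ≠ ⊤ := by
  have hlim := ProbabilityTheory.tendsto_cdf_atTop (μ.map ((↑) : ℝ≥0 → ℝ))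
  obtain ⟨x, hx⟩ := (hlim.eventually (lt_mem_nhds hp)).exists
  have : quantile μ p ≤ x.toNNReal :=
    quantile_le_iff.2 (hx.le.trans (distFun_mono μ (Real.le_coe_toNNReal x)))
  exact ne_top_of_le_ne_top ENNReal.coe_ne_top this

theorem distFun_of_neg [IsProbabilityMeasure μ] {x : ℝ} (hx : x < 0) : distFun μ x = 0 := by
  refine le_antisymm (ENNReal.ofReal_eq_zero.1 ?_) (distFun_nonneg μ x)
  rw [ofReal_distFun]
  exact measure_mono_null (fun y hy => (hx.trans_le y.2).not_ge hy) measure_empty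

theorem exists_distFun_le_iff [IsProbabilityMeasure μ] (hμ : Continuous (distFun μ)) {p : ℝ}
    (hp : p ∈ Set.Ico (0 : ℝ) 1) : ∃ a, distFun μ a = p ∧ ∀ x, distFun μ x ≤ p ↔ x ≤ a := by
  have htop := ProbabilityTheory.tendsto_cdf_atTop (μ.map ((↑) : ℝ≥0 → ℝ))
  obtain ⟨b, hb⟩ := (htop.eventually (lt_mem_nhds hp.2)).exists
  obtain ⟨z, hz⟩ := mem_range_of_exists_le_of_exists_ge hμ
    ⟨-1, (distFun_of_neg neg_one_lt_zero).trans_le hp.1⟩ ⟨b, hb.le⟩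
  have hbdd : BddAbove {x | distFun μ x ≤ p} :=
    ⟨b, fun x hx => le_of_not_gt fun hbx => (hx.trans_lt hb).not_ge (distFun_mono μ hbx.le)⟩
  have hmem : sSup {x | distFun μ x ≤ p} ∈ {x | distFun μ x ≤ p} :=
    (isClosed_le hμ continuous_const).csSup_mem ⟨z, hz.le⟩ hbdd
  exact ⟨_, le_antisymm hmem (hz.ge.trans (distFun_mono μ (le_csSup hbdd hz.le))), fun x =>
    ⟨fun hx => le_csSup hbdd hx, fun hx => (distFun_mono μ hx).trans hmem⟩⟩

theorem measure_distFun_le [IsProbabilityMeasure μ] (hμ : Continuous (distFun μ)) {p : ℝ}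
    (hp : p ∈ Set.Icc (0 : ℝ) 1) : μ {x | distFun μ x ≤ p} = ENNReal.ofReal p := by
  rcases hp.2.lt_or_eq with hp1 | rfl
  · obtain ⟨a, rfl, ha⟩ := exists_distFun_le_iff hμ ⟨hp.1, hp1⟩
    simp only [ha, ofReal_distFun]
  · simp [distFun_le_one]

theorem map_distFun [IsProbabilityMeasure μ] (hμ : Continuous (distFun μ)) :
    μ.map (fun x : ℝ≥0 => distFun μ x) = volume.restrict (Set.Icc 0 1) := by
  have hm : Measurable fun x : ℝ≥0 => distFun μ x := hμ.measurable.comp (by fun_prop)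
  have : IsProbabilityMeasure (μ.map fun x : ℝ≥0 => distFun μ x) :=
    Measure.isProbabilityMeasure_map hm.aemeasurable
  refine Measure.ext_of_Iic _ _ fun p => ?_
  rw [Measure.map_apply hm measurableSet_Iic, Measure.restrict_apply measurableSet_Iic]
  have hclamp : {x : ℝ≥0 | distFun μ x ≤ p} = {x : ℝ≥0 | distFun μ x ≤ min p 1} := by
    simp [distFun_le_one]
  change μ {x | distFun μ x ≤ p} = _
  rcases lt_or_ge p 0 with hp | hp
  · have hempty : Set.Iic p ∩ Set.Icc 0 1 = ∅ :=
      Set.disjoint_iff_inter_eq_empty.1 (Set.disjoint_left.2 fun q hq hq' =>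
        (hq'.1.trans hq).not_gt hp)
    rw [hempty, measure_empty]
    exact measure_mono_null (fun x hx => (hp.trans_le (distFun_nonneg μ x)).not_ge hx)
      measure_empty
  · have hinter : Set.Iic p ∩ Set.Icc 0 1 = Set.Icc 0 (min p 1) := by
      ext q; simp only [Set.mem_inter_iff, Set.mem_Iic, Set.mem_Icc, le_inf_iff]; tauto
    rw [hclamp, measure_distFun_le hμ ⟨le_min hp zero_le_one, min_le_right _ _⟩, hinter,
      Real.volume_Icc, sub_zero]

theorem ae_distFun_mem_Ioo [IsProbabilityMeasure μ] (hμ : Continuous (distFun μ)) :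
    ∀ᵐ x : ℝ≥0 ∂μ, distFun μ x ∈ Set.Ioo (0 : ℝ) 1 := by
  have hIoo : ∀ᵐ p : ℝ ∂volume.restrict (Set.Icc 0 1), p ∈ Set.Ioo (0 : ℝ) 1 := by
    rw [← restrict_Ioo_eq_restrict_Icc]
    exact ae_restrict_mem measurableSet_Ioo
  rw [← map_distFun hμ] at hIoo
  exact ae_of_ae_map (hμ.measurable.comp (by fun_prop)).aemeasurable hIoo

/-- The monotone transport map `F_ν⁻¹ ∘ F_μ`, which maps `μ` to `ν` if `F_μ` is continuous. It is
meaningful where `F_μ` lies in `(0, 1)`; infinite quantiles are replaced by `0`. -/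
noncomputable def transport (μ ν : Measure ℝ≥0) (x : ℝ≥0) : ℝ≥0 :=
  (quantile ν (distFun μ x)).toNNReal

theorem measurable_transport (μ ν : Measure ℝ≥0) : Measurable (transport μ ν) :=
  ENNReal.measurable_toNNReal.comp
    ((quantile_mono ν).measurable.comp ((distFun_mono μ).measurable.comp (by fun_prop)))

theorem coe_transport {x : ℝ≥0} (hx : distFun μ x < 1) :
    (transport μ ν x : ℝ≥0∞) = quantile ν (distFun μ x) :=
  ENNReal.coe_toNNReal (quantile_ne_top hx)

theorem monotoneOn_transport (μ ν : Measure ℝ≥0) :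
    MonotoneOn (transport μ ν) {x : ℝ≥0 | distFun μ x ∈ Set.Ioo (0 : ℝ) 1} :=
  fun _ _ _ hy hxy => ENNReal.toNNReal_mono (quantile_ne_top hy.2)
    (quantile_mono ν (distFun_mono μ (NNReal.coe_le_coe.2 hxy)))

theorem transport_le_iff {x y : ℝ≥0} (hx : distFun μ x < 1) :
    transport μ ν x ≤ y ↔ distFun μ x ≤ distFun ν y := by
  rw [← ENNReal.coe_le_coe, coe_transport hx, quantile_le_iff]

theorem map_transport [IsProbabilityMeasure μ] [IsProbabilityMeasure ν]
    (hμ : Continuous (distFun μ)) : μ.map (transport μ ν) = ν := by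
  have : IsProbabilityMeasure (μ.map (transport μ ν)) :=
    Measure.isProbabilityMeasure_map (measurable_transport μ ν).aemeasurable
  refine Measure.ext_of_Iic _ _ fun y => ?_
  have hset : transport μ ν ⁻¹' Set.Iic y =ᵐ[μ] {x : ℝ≥0 | distFun μ x ≤ distFun ν y} := by
    filter_upwards [ae_distFun_mem_Ioo hμ] with x hx
    exact propext (transport_le_iff hx.2)
  rw [Measure.map_apply (measurable_transport μ ν) measurableSet_Iic, measure_congr hset,
    measure_distFun_le hμ ⟨distFun_nonneg _ _, distFun_le_one _ _⟩, ofReal_distFun]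
  rfl

/-- `Y` is `P`-almost surely a nondecreasing function of `L`. -/
def NondecreasingIn (P : Measure Ω) (L Y : Ω → ℝ≥0) : Prop :=
  ∃ A : Set Ω, (∀ᵐ ω ∂P, ω ∈ A) ∧ ∀ ω ∈ A, ∀ ω' ∈ A, L ω ≤ L ω' → Y ω ≤ Y ω'

theorem NondecreasingIn.of_monotoneOn {D : Set ℝ≥0} {g : ℝ≥0 → ℝ≥0} (hg : MonotoneOn g D)
    (hD : ∀ᵐ ω ∂P, L ω ∈ D) (hY : ∀ᵐ ω ∂P, Y ω = g (L ω)) : NondecreasingIn P L Y := by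
  refine ⟨{ω | L ω ∈ D ∧ Y ω = g (L ω)}, hD.and hY, fun ω hω ω' hω' hle => ?_⟩
  rw [hω.2, hω'.2]
  exact hg hω.1 hω'.1 hle

theorem ae_distFun_law_mem_Ioo [IsProbabilityMeasure P] (hL : Measurable L)
    (hcont : Continuous (distFun (law P L))) :
    ∀ᵐ ω ∂P, distFun (law P L) (L ω) ∈ Set.Ioo (0 : ℝ) 1 :=
  have := isProbabilityMeasure_law (P := P) hL
  ae_of_ae_map hL.aemeasurable (ae_distFun_mem_Ioo (μ := law P L) hcont)

theorem law_transport_comp [IsProbabilityMeasure P] (hL : Measurable L) (hX : Measurable X)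
    (hcont : Continuous (distFun (law P L))) :
    law P (fun ω => transport (law P L) (law P X) (L ω)) = law P X := by
  have := isProbabilityMeasure_law (P := P) hL
  have := isProbabilityMeasure_law (P := P) hX
  exact (Measure.map_map (measurable_transport _ _) hL).symm.trans (map_transport hcont)

theorem nondecreasingIn_iff_ae_eq_transport [IsProbabilityMeasure P] (hL : Measurable L)
    (hX : Measurable X) (hcont : Continuous (distFun (law P L))) :
    NondecreasingIn P L X ↔ X =ᵐ[P] fun ω => transport (law P L) (law P X) (L ω) := by
  have hIoo := ae_distFun_law_mem_Ioo hL hcont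
  refine ⟨fun ⟨A, hA, hmono⟩ => ?_, .of_monotoneOn (monotoneOn_transport _ _) hIoo⟩
  refine (ae_eq_of_ae_le_of_law_eq ((measurable_transport _ _).comp hL) hX ?_
    (law_transport_comp hL hX hcont)).symm
  filter_upwards [hA, hIoo] with ω hω hlt
  refine (transport_le_iff hlt.2).2 ((ENNReal.ofReal_le_ofReal_iff (distFun_nonneg _ _)).1 ?_)
  rw [ofReal_distFun_law hL, ofReal_distFun_law hX]
  refine measure_mono_ae ?_
  filter_upwards [hA] with ω' hω' hle
  exact NNReal.coe_le_coe.2 (hmono ω' hω' ω hω (NNReal.coe_le_coe.1 hle))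

end Distributions

/-! ### Integral orders -/

section IntegralOrder

variable {Ω Ω' : Type*} [MeasurableSpace Ω] [MeasurableSpace Ω'] {P : Measure Ω} {P' : Measure Ω'}
  {𝔽 : Set (ℝ≥0 → ℝ)} {μ ν : Measure ℝ≥0}

theorem IntegralOrder.mono {𝔾 : Set (ℝ≥0 → ℝ)} (hsub : 𝔾 ⊆ 𝔽) (h : IntegralOrder 𝔽 μ ν) :
    IntegralOrder 𝔾 μ ν :=
  fun f hf => h f (hsub hf)

theorem integralOrder_law_iff (hFSD : 𝔽 ⊆ FSD) {X : Ω → ℝ≥0} {Y : Ω' → ℝ≥0} (hX : Measurable X)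
    (hY : Measurable Y) :
    IntegralOrder 𝔽 (law P X) (law P' Y) ↔
      ∀ f ∈ 𝔽, Integrable (fun ω => f (X ω)) P → Integrable (fun ω => f (Y ω)) P' →
        ∫ ω, f (X ω) ∂P ≤ ∫ ω, f (Y ω) ∂P' := by
  refine forall₂_congr fun f hf => ?_
  have hfm : ∀ κ : Measure ℝ≥0, AEStronglyMeasurable f κ := fun κ =>
    (Monotone.measurable (hFSD hf)).aestronglyMeasurable
  rw [law, law, integrable_map_measure (hfm _) hX.aemeasurable,
    integrable_map_measure (hfm _) hY.aemeasurable, integral_map hX.aemeasurable (hfm _),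
    integral_map hY.aemeasurable (hfm _)]
  rfl

theorem IntegralOrder.law_comp {𝔾 : Set (ℝ≥0 → ℝ)} (hFSD : 𝔽 ⊆ FSD) {X : Ω → ℝ≥0} {Y : Ω' → ℝ≥0}
    (hX : Measurable X) (hY : Measurable Y) {g : ℝ≥0 → ℝ≥0} (hg : Measurable g)
    (hcomp : ∀ f ∈ 𝔾, (fun x => f (g x)) ∈ 𝔽) (h𝔾 : 𝔾 ⊆ FSD)
    (h : IntegralOrder 𝔽 (law P X) (law P' Y)) :
    IntegralOrder 𝔾 (law P fun ω => g (X ω)) (law P' fun ω => g (Y ω)) :=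
  (integralOrder_law_iff h𝔾 (hg.comp hX) (hg.comp hY)).2 fun f hf =>
    (integralOrder_law_iff hFSD hX hY).1 h _ (hcomp f hf)

theorem tendsto_integral_min {α : Type*} [MeasurableSpace α] {κ : Measure α} {f : α → ℝ}
    (hf : Integrable f κ) :
    Filter.Tendsto (fun n : ℕ => ∫ x, min (f x) n ∂κ) Filter.atTop (nhds (∫ x, f x ∂κ)) := by
  refine tendsto_integral_of_dominated_convergence (fun x => |f x|)
    (fun n => hf.aestronglyMeasurable.inf aestronglyMeasurable_const) hf.abs (fun n => ?_) ?_
  · filter_upwards with x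
    rcases min_cases (f x) (n : ℝ) with h | h
    · rw [h.1, Real.norm_eq_abs]
    · rw [h.1, Real.norm_eq_abs, Nat.abs_cast]
      exact h.2.le.trans (le_abs_self _)
  · filter_upwards with x
    obtain ⟨m, hm⟩ := exists_nat_ge (f x)
    refine tendsto_const_nhds.congr' ?_
    filter_upwards [Filter.eventually_ge_atTop m] with n hn
    exact (min_eq_left (hm.trans (Nat.cast_le.2 hn))).symm

theorem IntegralOrder.integral_le_of_monotoneOn [IsFiniteMeasure μ] [IsFiniteMeasure ν]
    (h : IntegralOrder FSD μ ν) {D : Set ℝ≥0} (hDμ : ∀ᵐ x ∂μ, x ∈ D) (hDν : ∀ᵐ x ∂ν, x ∈ D)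
    {f : ℝ≥0 → ℝ} (hf : MonotoneOn f D) (hbelow : BddBelow (f '' D)) (hμ : Integrable f μ)
    (hν : Integrable f ν) : ∫ x, f x ∂μ ≤ ∫ x, f x ∂ν := by
  -- Truncated from above, `f` is bounded on `D` and extends to a monotone function on `[0, ∞)`.
  refine le_of_tendsto_of_tendsto' (tendsto_integral_min hμ) (tendsto_integral_min hν) fun n => ?_
  obtain ⟨b, hb⟩ := hbelow
  obtain ⟨g, hg, hgf⟩ := MonotoneOn.exists_monotone_extension (f := fun x => min (f x) n)
    (fun x hx y hy hxy => min_le_min_right _ (hf hx hy hxy))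
    ⟨min b n, by rintro _ ⟨x, hx, rfl⟩; exact min_le_min_right _ (hb ⟨x, hx, rfl⟩)⟩
    ⟨n, by rintro _ ⟨x, -, rfl⟩; exact min_le_right _ _⟩
  have hint : ∀ κ : Measure ℝ≥0, IsFiniteMeasure κ → (∀ᵐ x ∂κ, x ∈ D) → Integrable f κ →
      Integrable g κ ∧ ∫ x, min (f x) n ∂κ = ∫ x, g x ∂κ := fun κ _ hD hκ =>
    have heq : (fun x => min (f x) (n : ℝ)) =ᵐ[κ] g := hD.mono fun x hx => hgf hx
    ⟨(hκ.inf (integrable_const _)).congr heq, integral_congr_ae heq⟩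
  obtain ⟨hgμ, hμeq⟩ := hint μ inferInstance hDμ hμ
  obtain ⟨hgν, hνeq⟩ := hint ν inferInstance hDν hν
  rw [hμeq, hνeq]
  exact h g hg hgμ hgν

theorem IntegralOrder.law_comp_of_monotoneOn [IsFiniteMeasure P] [IsFiniteMeasure P']
    {X : Ω → ℝ≥0} {Y : Ω' → ℝ≥0} (hX : Measurable X) (hY : Measurable Y)
    (h : IntegralOrder FSD (law P X) (law P' Y)) {D : Set ℝ≥0} (hD : MeasurableSet D)
    (hXD : ∀ᵐ ω ∂P, X ω ∈ D) (hYD : ∀ᵐ ω ∂P', Y ω ∈ D) {g : ℝ≥0 → ℝ≥0} (hgm : Measurable g)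
    (hg : MonotoneOn g D) :
    IntegralOrder FSD (law P fun ω => g (X ω)) (law P' fun ω => g (Y ω)) := by
  have hlaw : law P (fun ω => g (X ω)) = (law P X).map g := (Measure.map_map hgm hX).symm
  have hlaw' : law P' (fun ω => g (Y ω)) = (law P' Y).map g := (Measure.map_map hgm hY).symm
  intro f hf
  have hfm : ∀ κ : Measure ℝ≥0, AEStronglyMeasurable f κ := fun κ =>
    (Monotone.measurable hf).aestronglyMeasurable
  have : IsFiniteMeasure (law P X) := inferInstanceAs (IsFiniteMeasure (P.map X))
  have : IsFiniteMeasure (law P' Y) := inferInstanceAs (IsFiniteMeasure (P'.map Y))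
  rw [hlaw, hlaw', integrable_map_measure (hfm _) hgm.aemeasurable,
    integrable_map_measure (hfm _) hgm.aemeasurable, integral_map hgm.aemeasurable (hfm _),
    integral_map hgm.aemeasurable (hfm _)]
  exact h.integral_le_of_monotoneOn ((ae_map_iff hX.aemeasurable hD).2 hXD)
    ((ae_map_iff hY.aemeasurable hD).2 hYD) (Monotone.comp_monotoneOn hf hg)
    ⟨f 0, by rintro _ ⟨x, -, rfl⟩; exact hf zero_le⟩

theorem lintegral_pos_add_neg_le_of_integral_le {f : Ω → ℝ} {g : Ω' → ℝ} (hf : Integrable f P)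
    (hg : Integrable g P') (hle : ∫ ω, f ω ∂P ≤ ∫ ω, g ω ∂P') :
    (∫⁻ ω, ENNReal.ofReal (f ω) ∂P) + ∫⁻ ω, ENNReal.ofReal (-g ω) ∂P'
      ≤ (∫⁻ ω, ENNReal.ofReal (g ω) ∂P') + ∫⁻ ω, ENNReal.ofReal (-f ω) ∂P := by
  have hf₁ : ∫⁻ ω, ENNReal.ofReal (f ω) ∂P ≠ ⊤ := hf.lintegral_lt_top.ne
  have hf₂ : ∫⁻ ω, ENNReal.ofReal (-f ω) ∂P ≠ ⊤ := hf.neg.lintegral_lt_top.ne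
  have hg₁ : ∫⁻ ω, ENNReal.ofReal (g ω) ∂P' ≠ ⊤ := hg.lintegral_lt_top.ne
  have hg₂ : ∫⁻ ω, ENNReal.ofReal (-g ω) ∂P' ≠ ⊤ := hg.neg.lintegral_lt_top.ne
  rw [integral_eq_lintegral_pos_part_sub_lintegral_neg_part hf,
    integral_eq_lintegral_pos_part_sub_lintegral_neg_part hg] at hle
  rw [← ENNReal.toReal_le_toReal (by finiteness) (by finiteness), ENNReal.toReal_add hf₁ hg₂,
    ENNReal.toReal_add hg₁ hf₂]
  linarith

end IntegralOrder

/-! ### Concave utilities with prescribed marginal -/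

section Utility

variable {k : ℝ → ℝ≥0∞} {c s x z : ℝ≥0} {a b : ℝ}

theorem setLIntegral_Icc_add (k : ℝ → ℝ≥0∞) {d : ℝ} (hab : a ≤ b) (hbd : b ≤ d) :
    (∫⁻ y in Set.Icc a b, k y) + (∫⁻ y in Set.Icc b d, k y) = ∫⁻ y in Set.Icc a d, k y := by
  rw [← Set.Icc_union_Ioc_eq_Icc hab hbd, lintegral_union measurableSet_Ioc,
    setLIntegral_congr (Ioc_ae_eq_Icc (a := b) (b := d))]
  exact Set.disjoint_left.2 fun y h1 h2 => h2.1.not_ge h1.2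

theorem setLIntegral_Icc_of_le (k : ℝ → ℝ≥0∞) (hab : b ≤ a) : ∫⁻ y in Set.Icc a b, k y = 0 :=
  setLIntegral_measure_zero _ _ (by simpa only [Real.volume_Icc, ENNReal.ofReal_eq_zero,
    sub_nonpos] using hab)

/-- The positive part of the utility function `x ↦ ∫_c^x k` with marginal utility `k`. -/
noncomputable def gain (k : ℝ → ℝ≥0∞) (c x : ℝ≥0) : ℝ≥0∞ := ∫⁻ y in Set.Icc (c : ℝ) x, k y

/-- The negative part of the utility function `x ↦ ∫_c^x k` with marginal utility `k`; it may be
infinite even where `k` is finite. -/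
noncomputable def loss (k : ℝ → ℝ≥0∞) (c x : ℝ≥0) : ℝ≥0∞ := ∫⁻ y in Set.Icc (x : ℝ) c, k y

theorem gain_mono (k : ℝ → ℝ≥0∞) (c : ℝ≥0) : Monotone (gain k c) :=
  fun _ _ h => lintegral_mono_set (Set.Icc_subset_Icc_right (NNReal.coe_le_coe.2 h))

theorem loss_anti (k : ℝ → ℝ≥0∞) (c : ℝ≥0) : Antitone (loss k c) :=
  fun _ _ h => lintegral_mono_set (Set.Icc_subset_Icc_left (NNReal.coe_le_coe.2 h))

theorem measurable_gain (k : ℝ → ℝ≥0∞) (c : ℝ≥0) : Measurable (gain k c) :=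
  (gain_mono k c).measurable

theorem measurable_loss (k : ℝ → ℝ≥0∞) (c : ℝ≥0) : Measurable (loss k c) :=
  (loss_anti k c).measurable

theorem gain_eq_zero (k : ℝ → ℝ≥0∞) (h : x ≤ c) : gain k c x = 0 :=
  setLIntegral_Icc_of_le k (NNReal.coe_le_coe.2 h)

theorem loss_eq_zero (k : ℝ → ℝ≥0∞) (h : c ≤ x) : loss k c x = 0 :=
  setLIntegral_Icc_of_le k (NNReal.coe_le_coe.2 h)

theorem gain_add_loss_eq (k : ℝ → ℝ≥0∞) (c : ℝ≥0) (hxz : x ≤ z) :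
    gain k c z + loss k c x = gain k c x + loss k c z + ∫⁻ y in Set.Icc (x : ℝ) z, k y := by
  have hxz' : (x : ℝ) ≤ z := hxz
  rcases le_total c x with h | h
  · rw [loss_eq_zero k h, loss_eq_zero k (h.trans hxz), add_zero, add_zero]
    exact (setLIntegral_Icc_add k (NNReal.coe_le_coe.2 h) hxz').symm
  · rw [gain_eq_zero k h, zero_add]
    rcases le_total c z with h' | h'
    · rw [loss_eq_zero k h', zero_add, add_comm]
      exact setLIntegral_Icc_add k (NNReal.coe_le_coe.2 h) (NNReal.coe_le_coe.2 h')
    · rw [gain_eq_zero k h', zero_add, add_comm]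
      exact (setLIntegral_Icc_add k hxz' (NNReal.coe_le_coe.2 h')).symm

theorem setLIntegral_Icc_const (s : ℝ≥0∞) (hxz : x ≤ z) :
    ∫⁻ _ in Set.Icc (x : ℝ) z, s = s * (z - x) := by
  rw [setLIntegral_const, Real.volume_Icc, ← NNReal.coe_sub hxz, ENNReal.ofReal_coe_nnreal,
    ENNReal.coe_sub]

theorem setLIntegral_Icc_ne_top (hk : Antitone k) (hx : k x ≠ ⊤) (z : ℝ≥0) :
    ∫⁻ y in Set.Icc (x : ℝ) z, k y ≠ ⊤ := by
  refine ne_top_of_le_ne_top ?_ (setLIntegral_mono' measurableSet_Icc fun y hy => hk hy.1)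
  rw [setLIntegral_const, Real.volume_Icc]
  exact ENNReal.mul_ne_top hx ENNReal.ofReal_ne_top

theorem eq_zero_of_setLIntegral_Icc_eq_zero (hk : Antitone k) (h : ∫⁻ y in Set.Icc a b, k y = 0)
    {y : ℝ} (hy : y ∈ Set.Ioc a b) : k y = 0 := by
  have hle : k y * volume (Set.Icc a y) ≤ 0 := calc
    k y * volume (Set.Icc a y) = ∫⁻ _ in Set.Icc a y, k y := (setLIntegral_const _ _).symm
    _ ≤ ∫⁻ t in Set.Icc a y, k t := setLIntegral_mono' measurableSet_Icc fun t ht => hk ht.2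
    _ ≤ ∫⁻ t in Set.Icc a b, k t := lintegral_mono_set (Set.Icc_subset_Icc_right hy.2)
    _ = 0 := h
  simpa [hy.1.not_ge] using hle

theorem gain_ne_top (hk : Antitone k) (hc : k c ≠ ⊤) (x : ℝ≥0) : gain k c x ≠ ⊤ :=
  setLIntegral_Icc_ne_top hk hc x

theorem loss_ne_top (hk : Antitone k) (hx : k x ≠ ⊤) (c : ℝ≥0) : loss k c x ≠ ⊤ :=
  setLIntegral_Icc_ne_top hk hx c

/-! ### The tangent inequality -/

/-- The slope `s` supports the utility function `x ↦ ∫_c^x k` from above at `z`. -/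
def IsSupergradient (k : ℝ → ℝ≥0∞) (s z : ℝ≥0) : Prop :=
  (∀ y : ℝ, y < z → s ≤ k y) ∧ ∀ y : ℝ, z < y → k y ≤ s

/-- The line of slope `s` through the graph of the utility function `x ↦ ∫_c^x k` at `z` meets the
graph only at `z`. -/
def IsStrictSupergradient (k : ℝ → ℝ≥0∞) (s z : ℝ≥0) : Prop :=
  (∀ y : ℝ, y < z → s < k y) ∧ ∀ y : ℝ, z < y → k y < s

theorem IsStrictSupergradient.isSupergradient (h : IsStrictSupergradient k s z) :
    IsSupergradient k s z :=
  ⟨fun y hy => (h.1 y hy).le, fun y hy => (h.2 y hy).le⟩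

theorem isSupergradient_of_antitone (hk : Antitone k) (hz : k z ≠ ⊤) :
    IsSupergradient k (k z).toNNReal z := by
  rw [IsSupergradient, ENNReal.coe_toNNReal hz]
  exact ⟨fun y hy => hk hy.le, fun y hy => hk hy.le⟩

theorem gain_add_tangent_eq_of_le (k : ℝ → ℝ≥0∞) (c s : ℝ≥0) (hxz : x ≤ z) :
    gain k c x + (s * z + loss k c z)
        = gain k c x + loss k c z + s * x + ∫⁻ _ in Set.Icc (x : ℝ) z, (s : ℝ≥0∞) ∧
      gain k c z + (s * x + loss k c x)
        = gain k c x + loss k c z + s * x + ∫⁻ y in Set.Icc (x : ℝ) z, k y := by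
  have hz : (z : ℝ≥0∞) = x + (z - x) := (add_tsub_cancel_of_le (ENNReal.coe_le_coe.2 hxz)).symm
  constructor
  · rw [setLIntegral_Icc_const _ hxz]
    nth_rw 1 [hz]
    ring
  · rw [show gain k c z + (s * x + loss k c x) = gain k c z + loss k c x + s * x by ring,
      gain_add_loss_eq k c hxz]
    ring

theorem IsSupergradient.gain_add_le (h : IsSupergradient k s z) (c x : ℝ≥0) :
    gain k c x + (s * z + loss k c z) ≤ gain k c z + (s * x + loss k c x) := by
  rcases le_total x z with hxz | hzx
  · obtain ⟨hl, hr⟩ := gain_add_tangent_eq_of_le k c s hxz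
    rw [hl, hr, setLIntegral_congr (Ico_ae_eq_Icc (a := (x : ℝ)) (b := z)).symm,
      setLIntegral_congr (Ico_ae_eq_Icc (a := (x : ℝ)) (b := z)).symm]
    gcongr _ + ?_
    exact setLIntegral_mono' measurableSet_Ico fun y hy => h.1 y hy.2
  · obtain ⟨hl, hr⟩ := gain_add_tangent_eq_of_le k c s hzx
    rw [hl, hr, setLIntegral_congr (Ioc_ae_eq_Icc (a := (z : ℝ)) (b := x)).symm,
      setLIntegral_congr (Ioc_ae_eq_Icc (a := (z : ℝ)) (b := x)).symm]
    gcongr _ + ?_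
    exact setLIntegral_mono' measurableSet_Ioc fun y hy => h.2 y hy.1

theorem IsStrictSupergradient.gain_add_lt (h : IsStrictSupergradient k s z) (hk : Measurable k)
    (hgx : gain k c x ≠ ⊤) (hlx : loss k c x ≠ ⊤) (hgz : gain k c z ≠ ⊤) (hlz : loss k c z ≠ ⊤)
    (hxz : x ≠ z) : gain k c x + (s * z + loss k c z) < gain k c z + (s * x + loss k c x) := by
  rcases lt_or_gt_of_ne hxz with hlt | hlt
  · obtain ⟨hl, hr⟩ := gain_add_tangent_eq_of_le k c s hlt.le
    rw [hl, hr]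
    refine ENNReal.add_lt_add_left (by finiteness)
      (setLIntegral_strict_mono measurableSet_Icc ?_ hk ?_ ?_)
    · simpa [Real.volume_Icc] using hlt
    · rw [setLIntegral_Icc_const _ hlt.le]; finiteness
    · filter_upwards [Measure.ae_ne volume (z : ℝ)] with y hyz hy
      exact h.1 y (lt_of_le_of_ne hy.2 hyz)
  · obtain ⟨hl, hr⟩ := gain_add_tangent_eq_of_le k c s hlt.le
    have hfin : ∫⁻ y in Set.Icc (z : ℝ) x, k y ≠ ⊤ := by
      refine ne_top_of_le_ne_top (b := gain k c x + loss k c z) (by finiteness) ?_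
      rw [gain_add_loss_eq k c hlt.le]
      exact le_add_self
    rw [hl, hr]
    refine ENNReal.add_lt_add_left (by finiteness)
      (setLIntegral_strict_mono measurableSet_Icc ?_ measurable_const hfin ?_)
    · simpa [Real.volume_Icc] using hlt
    · filter_upwards [Measure.ae_ne volume (z : ℝ)] with y hyz hy
      exact h.2 y (lt_of_le_of_ne hy.1 hyz.symm)

end Utility

/-! ### Expected gains and losses under an integral order -/

section UtilityOrder

variable {k : ℝ → ℝ≥0∞} {c : ℝ≥0} {μ ν : Measure ℝ≥0}

theorem mem_SSD_of_forall_exists_supporting_line {f : ℝ≥0 → ℝ}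
    (h : ∀ z, ∃ s : ℝ≥0, ∀ x : ℝ≥0, f x ≤ f z + s * (x - z)) : f ∈ SSD := by
  refine ⟨fun x z hxz => ?_, convex_univ, fun x _ z _ a b _ _ hab => ?_⟩
  · obtain ⟨s, hs⟩ := h z
    have : (s : ℝ) * (x - z) ≤ 0 :=
      mul_nonpos_of_nonneg_of_nonpos s.2 (sub_nonpos.2 (NNReal.coe_le_coe.2 hxz))
    linarith [hs x]
  · obtain ⟨s, hs⟩ := h (a • x + b • z)
    have hab' : (a : ℝ) + b = 1 := by exact_mod_cast hab
    simp only [NNReal.smul_def, smul_eq_mul, NNReal.coe_add, NNReal.coe_mul] at hs ⊢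
    calc (a : ℝ) * f x + b * f z
        ≤ a * (f (a • x + b • z) + s * (x - (a * x + b * z)))
          + b * (f (a • x + b • z) + s * (z - (a * x + b * z))) := by
          gcongr
          exacts [hs x, hs z]
      _ = f (a • x + b • z) := by
          rw [← eq_sub_iff_add_eq] at hab'
          rw [hab']
          ring

theorem min_zero_mem_SSD {f : ℝ≥0 → ℝ} (hf : f ∈ SSD) : (fun x => min (f x) 0) ∈ SSD :=
  ⟨fun _ _ hxy => min_le_min_right _ (hf.1 hxy), hf.2.inf (concaveOn_const 0 convex_univ)⟩

/-- The utility function `x ↦ ∫_c^x k` as a real-valued function, for finite `k`. -/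
noncomputable def realUtility (k : ℝ → ℝ≥0∞) (c x : ℝ≥0) : ℝ :=
  (gain k c x).toReal - (loss k c x).toReal

theorem realUtility_mem_SSD (hk : Antitone k) (hfin : ∀ y, k y ≠ ⊤) (c : ℝ≥0) :
    realUtility k c ∈ SSD := by
  refine mem_SSD_of_forall_exists_supporting_line fun z => ⟨(k z).toNNReal, fun x => ?_⟩
  have hg : ∀ y : ℝ≥0, gain k c y ≠ ⊤ := gain_ne_top hk (hfin c)
  have hl : ∀ y : ℝ≥0, loss k c y ≠ ⊤ := fun y => loss_ne_top hk (hfin y) c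
  have htangent := (isSupergradient_of_antitone hk (hfin z)).gain_add_le c x
  rw [← ENNReal.toReal_le_toReal (by finiteness [hg x, hl z]) (by finiteness [hg z, hl x]),
    ENNReal.toReal_add (hg x) (by finiteness [hl z]), ENNReal.toReal_add (by finiteness) (hl z),
    ENNReal.toReal_add (hg z) (by finiteness [hl x]), ENNReal.toReal_add (by finiteness) (hl x),
    ENNReal.toReal_mul, ENNReal.toReal_mul] at htangent
  simp only [ENNReal.coe_toReal] at htangent
  rw [realUtility, realUtility]
  linarith

theorem ofReal_realUtility (hk : Antitone k) (hc : k c ≠ ⊤) (x : ℝ≥0) :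
    ENNReal.ofReal (realUtility k c x) = gain k c x := by
  rw [realUtility]
  rcases le_total c x with h | h
  · rw [loss_eq_zero k h, ENNReal.toReal_zero, sub_zero,
      ENNReal.ofReal_toReal (gain_ne_top hk hc x)]
  · rw [gain_eq_zero k h, ENNReal.toReal_zero, zero_sub, ENNReal.ofReal_eq_zero, neg_nonpos]
    exact ENNReal.toReal_nonneg

theorem ofReal_neg_realUtility (hk : Antitone k) (hfin : ∀ y, k y ≠ ⊤) (c x : ℝ≥0) :
    ENNReal.ofReal (-realUtility k c x) = loss k c x := by
  rw [realUtility, neg_sub]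
  rcases le_total c x with h | h
  · rw [loss_eq_zero k h, ENNReal.toReal_zero, zero_sub, ENNReal.ofReal_eq_zero, neg_nonpos]
    exact ENNReal.toReal_nonneg
  · rw [gain_eq_zero k h, ENNReal.toReal_zero, sub_zero,
      ENNReal.ofReal_toReal (loss_ne_top hk (hfin x) c)]

theorem integrable_of_lintegral_ofReal_ne_top {α : Type*} [MeasurableSpace α] {κ : Measure α}
    {f : α → ℝ} (hf : Measurable f) (hpos : ∫⁻ x, ENNReal.ofReal (f x) ∂κ ≠ ⊤)
    (hneg : ∫⁻ x, ENNReal.ofReal (-f x) ∂κ ≠ ⊤) : Integrable f κ := by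
  refine ⟨hf.aestronglyMeasurable, ?_⟩
  rw [hasFiniteIntegral_iff_norm]
  calc ∫⁻ x, ENNReal.ofReal ‖f x‖ ∂κ
      ≤ ∫⁻ x, (ENNReal.ofReal (f x) + ENNReal.ofReal (-f x)) ∂κ := by
        refine lintegral_mono fun x => ?_
        rw [Real.norm_eq_abs, abs_eq_max_neg, ENNReal.ofReal_max]
        exact max_le le_self_add le_add_self
    _ = (∫⁻ x, ENNReal.ofReal (f x) ∂κ) + ∫⁻ x, ENNReal.ofReal (-f x) ∂κ :=
        lintegral_add_left hf.ennreal_ofReal _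
    _ < ⊤ := ENNReal.add_lt_top.2 ⟨hpos.lt_top, hneg.lt_top⟩

theorem lintegral_loss_ne_top_of_le [IsFiniteMeasure μ] {s : ℝ≥0} (hks : ∀ y, k y ≤ s) (c : ℝ≥0) :
    ∫⁻ x, loss k c x ∂μ ≠ ⊤ := by
  have hloss : ∀ x : ℝ≥0, loss k c x ≤ s * c := fun x =>
    calc loss k c x ≤ loss k c 0 := loss_anti k c (zero_le)
      _ ≤ ∫⁻ _ in Set.Icc ((0 : ℝ≥0) : ℝ) c, (s : ℝ≥0∞) := lintegral_mono hks
      _ = s * c := by rw [setLIntegral_Icc_const _ (zero_le), ENNReal.coe_zero, tsub_zero]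
  refine ne_top_of_le_ne_top ?_ (lintegral_mono hloss)
  rw [lintegral_const]
  finiteness

theorem lintegral_gain_add_loss_le_of_le [IsFiniteMeasure μ] [IsFiniteMeasure ν]
    (h : IntegralOrder SSD μ ν) (hk : Antitone k) {s : ℝ≥0} (hks : ∀ y, k y ≤ s) (c : ℝ≥0)
    (hμ : ∫⁻ x, gain k c x ∂μ ≠ ⊤) (hν : ∫⁻ x, gain k c x ∂ν ≠ ⊤) :
    ∫⁻ x, gain k c x ∂μ + ∫⁻ x, loss k c x ∂ν ≤ ∫⁻ x, gain k c x ∂ν + ∫⁻ x, loss k c x ∂μ := by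
  have hfin : ∀ y, k y ≠ ⊤ := fun y => ne_top_of_le_ne_top ENNReal.coe_ne_top (hks y)
  have hmem := realUtility_mem_SSD hk hfin c
  have hint : ∀ κ : Measure ℝ≥0, IsFiniteMeasure κ → ∫⁻ x, gain k c x ∂κ ≠ ⊤ →
      Integrable (realUtility k c) κ := fun κ _ hκ =>
    integrable_of_lintegral_ofReal_ne_top hmem.1.measurable
      (by simpa only [ofReal_realUtility hk (hfin c)] using hκ)
      (by simpa only [ofReal_neg_realUtility hk hfin] using lintegral_loss_ne_top_of_le hks c)
  have hle := lintegral_pos_add_neg_le_of_integral_le (hint μ inferInstance hμ)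
    (hint ν inferInstance hν) (h _ hmem (hint μ inferInstance hμ) (hint ν inferInstance hν))
  simpa only [ofReal_realUtility hk (hfin c), ofReal_neg_realUtility hk hfin] using hle

theorem lintegral_loss_le_of_le [IsFiniteMeasure μ] [IsFiniteMeasure ν]
    (h : IntegralOrder SSD μ ν) (hk : Antitone k) {s : ℝ≥0} (hks : ∀ y, k y ≤ s) (c : ℝ≥0) :
    ∫⁻ x, loss k c x ∂ν ≤ ∫⁻ x, loss k c x ∂μ := by
  have hfin : ∀ y, k y ≠ ⊤ := fun y => ne_top_of_le_ne_top ENNReal.coe_ne_top (hks y)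
  have hmem := min_zero_mem_SSD (realUtility_mem_SSD hk hfin c)
  have hpos : ∀ x, ENNReal.ofReal (min (realUtility k c x) 0) = 0 := fun x =>
    ENNReal.ofReal_eq_zero.2 (min_le_right _ _)
  have hneg : ∀ x, ENNReal.ofReal (-min (realUtility k c x) 0) = loss k c x := fun x => by
    rw [← max_neg_neg, neg_zero, ENNReal.ofReal_max, ofReal_neg_realUtility hk hfin,
      ENNReal.ofReal_zero, max_zero]
  have hint : ∀ κ : Measure ℝ≥0, IsFiniteMeasure κ →
      Integrable (fun x => min (realUtility k c x) 0) κ := fun κ _ =>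
    integrable_of_lintegral_ofReal_ne_top hmem.1.measurable
      (by simp only [hpos, lintegral_zero]; exact ENNReal.zero_ne_top)
      (by simpa only [hneg] using lintegral_loss_ne_top_of_le hks c)
  have hle := lintegral_pos_add_neg_le_of_integral_le (hint μ inferInstance)
    (hint ν inferInstance) (h _ hmem (hint μ inferInstance) (hint ν inferInstance))
  simpa only [hpos, hneg, lintegral_zero, zero_add] using hle

theorem lintegral_loss_eq_iSup (hk : Antitone k) (c : ℝ≥0) (μ : Measure ℝ≥0) :
    ∫⁻ x, loss k c x ∂μ = ⨆ n : ℕ, ∫⁻ x, loss (fun y => min (k y) n) c x ∂μ := by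
  have hmono : ∀ y, Monotone fun n : ℕ => min (k y) n := fun y m n hmn =>
    min_le_min_left _ (Nat.cast_le.2 hmn)
  rw [← lintegral_iSup (fun n => measurable_loss _ c)
    fun m n hmn x => lintegral_mono fun y => hmono y hmn]
  refine lintegral_congr fun x => ?_
  simp only [loss]
  rw [← lintegral_iSup (fun n => hk.measurable.min measurable_const) fun m n hmn y => hmono y hmn]
  exact lintegral_congr fun y => by rw [← inf_iSup_eq, ENNReal.iSup_natCast, inf_top_eq]

theorem antitone_min_natCast (hk : Antitone k) (n : ℕ) : Antitone fun y => min (k y) n :=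
  fun _ _ hxy => min_le_min_right _ (hk hxy)

theorem gain_min_natCast (hk : Antitone k) {n : ℕ} (hn : k c ≤ n) (x : ℝ≥0) :
    gain (fun y => min (k y) n) c x = gain k c x :=
  setLIntegral_congr_fun measurableSet_Icc fun _ hy => min_eq_left ((hk hy.1).trans hn)

theorem lintegral_loss_le [IsFiniteMeasure μ] [IsFiniteMeasure ν] (h : IntegralOrder SSD μ ν)
    (hk : Antitone k) (c : ℝ≥0) : ∫⁻ x, loss k c x ∂ν ≤ ∫⁻ x, loss k c x ∂μ := by
  rw [lintegral_loss_eq_iSup hk c μ, lintegral_loss_eq_iSup hk c ν]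
  exact iSup_mono fun n =>
    lintegral_loss_le_of_le h (antitone_min_natCast hk n) (s := n) (fun _ => min_le_right _ _) c

theorem lintegral_gain_add_loss_le [IsFiniteMeasure μ] [IsFiniteMeasure ν]
    (h : IntegralOrder SSD μ ν) (hk : Antitone k) (hc : k c ≠ ⊤)
    (hμ : ∫⁻ x, gain k c x ∂μ ≠ ⊤) (hν : ∫⁻ x, gain k c x ∂ν ≠ ⊤) :
    ∫⁻ x, gain k c x ∂μ + ∫⁻ x, loss k c x ∂ν ≤ ∫⁻ x, gain k c x ∂ν + ∫⁻ x, loss k c x ∂μ := by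
  obtain ⟨m, hm⟩ := ENNReal.exists_nat_gt hc
  rw [lintegral_loss_eq_iSup hk c ν, ENNReal.add_iSup]
  refine iSup_le fun n => ?_
  have hgain : ∀ x, gain (fun y => min (k y) (max n m : ℕ)) c x = gain k c x :=
    gain_min_natCast hk (hm.le.trans (Nat.cast_le.2 (le_max_right n m)))
  have hle := lintegral_gain_add_loss_le_of_le (k := fun y => min (k y) (max n m : ℕ))
    (s := (max n m : ℕ)) h (antitone_min_natCast hk _) (fun _ => min_le_right _ _) c
    (by simpa only [hgain] using hμ) (by simpa only [hgain] using hν)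
  simp only [hgain] at hle
  calc ∫⁻ x, gain k c x ∂μ + ∫⁻ x, loss (fun y => min (k y) n) c x ∂ν
      ≤ ∫⁻ x, gain k c x ∂μ + ∫⁻ x, loss (fun y => min (k y) (max n m : ℕ)) c x ∂ν := by
        gcongr with x
        exact lintegral_mono fun y => min_le_min_left _ (Nat.cast_le.2 (le_max_left n m))
    _ ≤ _ := hle
    _ ≤ ∫⁻ x, gain k c x ∂ν + ∫⁻ x, loss k c x ∂μ := by
        gcongr with x
        exact lintegral_mono fun y => min_le_left _ _

end UtilityOrder

/-! ### Optimality of a payoff at which the state price is a supergradient -/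

section Optimality

variable {Ω : Type*} [MeasurableSpace Ω] {P : Measure Ω} {ξ Y Z : Ω → ℝ≥0} {k : ℝ → ℝ≥0∞}
  {c : ℝ≥0}

theorem lintegral_gain_add_mul_add_loss (hξ : Measurable ξ) (hY : Measurable Y)
    (hZ : Measurable Z) (k : ℝ → ℝ≥0∞) (c : ℝ≥0) :
    ∫⁻ ω, (gain k c (Y ω) + (ξ ω * Z ω + loss k c (Z ω))) ∂P
      = ∫⁻ ω, gain k c (Y ω) ∂P + (∫⁻ ω, ξ ω * Z ω ∂P + ∫⁻ ω, loss k c (Z ω) ∂P) := by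
  rw [lintegral_add_left (f := fun ω => gain k c (Y ω)) ((measurable_gain k c).comp hY),
    lintegral_add_left (f := fun ω => (ξ ω : ℝ≥0∞) * Z ω) (by fun_prop)]

theorem lintegral_gain_add_le (hξ : Measurable ξ) (hY : Measurable Y) (hZ : Measurable Z)
    (h : ∀ᵐ ω ∂P, IsSupergradient k (ξ ω) (Z ω)) (c : ℝ≥0) :
    ∫⁻ ω, gain k c (Y ω) ∂P + (∫⁻ ω, ξ ω * Z ω ∂P + ∫⁻ ω, loss k c (Z ω) ∂P)
      ≤ ∫⁻ ω, gain k c (Z ω) ∂P + (∫⁻ ω, ξ ω * Y ω ∂P + ∫⁻ ω, loss k c (Y ω) ∂P) := by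
  rw [← lintegral_gain_add_mul_add_loss hξ hY hZ, ← lintegral_gain_add_mul_add_loss hξ hZ hY]
  exact lintegral_mono_ae (h.mono fun ω hω => hω.gain_add_le c (Y ω))

theorem lintegral_loss_ne_top (hξ : ∫⁻ ω, ξ ω ∂P ≠ ⊤)
    (h : ∀ᵐ ω ∂P, IsSupergradient k (ξ ω) (Z ω)) (c : ℝ≥0) : ∫⁻ ω, loss k c (Z ω) ∂P ≠ ⊤ := by
  have hle : ∀ᵐ ω ∂P, loss k c (Z ω) ≤ c * ξ ω := by
    filter_upwards [h] with ω hω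
    rcases le_total c (Z ω) with hc | hc
    · rw [loss_eq_zero k hc]
      exact zero_le
    · have htangent := hω.gain_add_le c c
      rw [gain_eq_zero k hc, gain_eq_zero k le_rfl, loss_eq_zero k le_rfl, zero_add, zero_add,
        add_zero, mul_comm _ (c : ℝ≥0∞)] at htangent
      exact le_add_self.trans htangent
  refine ne_top_of_le_ne_top ?_ (lintegral_mono_ae hle)
  rw [lintegral_const_mul' _ _ ENNReal.coe_ne_top]
  exact ENNReal.mul_ne_top ENNReal.coe_ne_top hξ

theorem lintegral_gain_ne_top (hZ : Measurable Z) (h : ∀ᵐ ω ∂P, IsSupergradient k (ξ ω) (Z ω))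
    (hgain : ∫⁻ ω, gain k c (Z ω) ∂P ≠ ⊤) (hcost : ∫⁻ ω, ξ ω * Y ω ∂P ≠ ⊤) :
    ∫⁻ ω, gain k c (Y ω) ∂P ≠ ⊤ := by
  have hle : ∀ᵐ ω ∂P, gain k c (Y ω) ≤ gain k c (Z ω) + ξ ω * Y ω := by
    filter_upwards [h] with ω hω
    rcases le_total c (Y ω) with hc | hc
    · have htangent := hω.gain_add_le c (Y ω)
      rw [loss_eq_zero k hc, add_zero] at htangent
      exact le_self_add.trans htangent
    · rw [gain_eq_zero k hc]
      exact zero_le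
  refine ne_top_of_le_ne_top ?_ (lintegral_mono_ae hle)
  rw [lintegral_add_left (f := fun ω => gain k c (Z ω)) ((measurable_gain k c).comp hZ)]
  exact ENNReal.add_ne_top.2 ⟨hgain, hcost⟩

theorem lintegral_gain_add_loss_le_of_cost_le (hξ : Measurable ξ) (hY : Measurable Y)
    (hZ : Measurable Z) (h : ∀ᵐ ω ∂P, IsSupergradient k (ξ ω) (Z ω))
    (hcost : ∫⁻ ω, ξ ω * Z ω ∂P ≠ ⊤) (hle : ∫⁻ ω, ξ ω * Y ω ∂P ≤ ∫⁻ ω, ξ ω * Z ω ∂P) :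
    ∫⁻ ω, gain k c (Y ω) ∂P + ∫⁻ ω, loss k c (Z ω) ∂P
      ≤ ∫⁻ ω, gain k c (Z ω) ∂P + ∫⁻ ω, loss k c (Y ω) ∂P := by
  have htangent := lintegral_gain_add_le hξ hY hZ h c
  rw [add_left_comm, add_left_comm (∫⁻ ω, gain k c (Z ω) ∂P)] at htangent
  exact (ENNReal.add_le_add_iff_left hcost).1 (htangent.trans (by gcongr))

theorem cost_le_of_lintegral_gain_add_loss_le (hξ : Measurable ξ) (hY : Measurable Y)
    (hZ : Measurable Z) (h : ∀ᵐ ω ∂P, IsSupergradient k (ξ ω) (Z ω))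
    (hgain : ∫⁻ ω, gain k c (Y ω) ∂P ≠ ⊤) (hloss : ∫⁻ ω, loss k c (Z ω) ∂P ≠ ⊤)
    (hle : ∫⁻ ω, gain k c (Z ω) ∂P + ∫⁻ ω, loss k c (Y ω) ∂P
      ≤ ∫⁻ ω, gain k c (Y ω) ∂P + ∫⁻ ω, loss k c (Z ω) ∂P) :
    ∫⁻ ω, ξ ω * Z ω ∂P ≤ ∫⁻ ω, ξ ω * Y ω ∂P := by
  have htangent := lintegral_gain_add_le hξ hY hZ h c
  rw [add_left_comm, add_left_comm (∫⁻ ω, gain k c (Z ω) ∂P), add_comm, add_comm _ (_ + _)]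
    at htangent
  exact (ENNReal.add_le_add_iff_left (ENNReal.add_ne_top.2 ⟨hgain, hloss⟩)).1
    (htangent.trans (by gcongr))

theorem ae_eq_of_cost_le_of_lintegral_gain_add_loss_le (hξ : Measurable ξ)
    (hY : Measurable Y) (hZ : Measurable Z) (hk : Measurable k)
    (h : ∀ᵐ ω ∂P, IsStrictSupergradient k (ξ ω) (Z ω)) (hcost : ∫⁻ ω, ξ ω * Z ω ∂P ≠ ⊤)
    (hgY : ∫⁻ ω, gain k c (Y ω) ∂P ≠ ⊤) (hgZ : ∫⁻ ω, gain k c (Z ω) ∂P ≠ ⊤)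
    (hlZ : ∫⁻ ω, loss k c (Z ω) ∂P ≠ ⊤) (hcost_le : ∫⁻ ω, ξ ω * Y ω ∂P ≤ ∫⁻ ω, ξ ω * Z ω ∂P)
    (hle : ∫⁻ ω, gain k c (Z ω) ∂P + ∫⁻ ω, loss k c (Y ω) ∂P
      ≤ ∫⁻ ω, gain k c (Y ω) ∂P + ∫⁻ ω, loss k c (Z ω) ∂P) : Y =ᵐ[P] Z := by
  have hgm : Measurable (gain k c) := measurable_gain k c
  have hlm : Measurable (loss k c) := measurable_loss k c
  have hlY : ∫⁻ ω, loss k c (Y ω) ∂P ≠ ⊤ :=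
    ne_top_of_le_ne_top (ENNReal.add_ne_top.2 ⟨hgY, hlZ⟩) (le_add_self.trans hle)
  have htangent := ae_eq_of_ae_le_of_lintegral_le
    (h.mono fun ω hω => hω.isSupergradient.gain_add_le c (Y ω))
    (by rw [lintegral_gain_add_mul_add_loss hξ hY hZ]; finiteness) (by fun_prop) (by
      rw [lintegral_gain_add_mul_add_loss hξ hY hZ, lintegral_gain_add_mul_add_loss hξ hZ hY,
        add_left_comm, add_left_comm (∫⁻ ω, gain k c (Y ω) ∂P)]
      gcongr)
  have hfinite : ∀ {f : ℝ≥0 → ℝ≥0∞} {V : Ω → ℝ≥0}, Measurable f → Measurable V →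
      ∫⁻ ω, f (V ω) ∂P ≠ ⊤ → ∀ᵐ ω ∂P, f (V ω) ≠ ⊤ := fun hf hV hfin =>
    (ae_lt_top (hf.comp hV) hfin).mono fun _ hω => hω.ne
  filter_upwards [h, htangent, hfinite hgm hY hgY, hfinite hlm hY hlY, hfinite hgm hZ hgZ,
    hfinite hlm hZ hlZ] with ω hω heq h₁ h₂ h₃ h₄
  by_contra hne
  exact (hω.gain_add_lt hk h₁ h₂ h₃ h₄ hne).ne heq

theorem ae_eq_zero_of_lintegral_gain_add_loss_le (hZ : Measurable Z) (hk : Antitone k)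
    (hgain : ∫⁻ ω, gain k c (Z ω) ∂P ≠ ⊤) (hloss : ∫⁻ ω, loss k c (Z ω) ∂P ≠ ⊤) (ε : ℝ≥0)
    (hle : ∫⁻ ω, gain k c (Z ω + ε) ∂P + ∫⁻ ω, loss k c (Z ω) ∂P
      ≤ ∫⁻ ω, gain k c (Z ω) ∂P + ∫⁻ ω, loss k c (Z ω + ε) ∂P) :
    ∀ᵐ ω ∂P, ∀ y ∈ Set.Ioc (Z ω : ℝ) (Z ω + ε), k y = 0 := by
  have hgm : Measurable (gain k c) := measurable_gain k c
  have hlm : Measurable (loss k c) := measurable_loss k c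
  have hZε : ∀ ω, Z ω ≤ Z ω + ε := fun ω => le_self_add
  have hfin : ∫⁻ ω, (gain k c (Z ω) + loss k c (Z ω + ε)) ∂P ≠ ⊤ := by
    rw [lintegral_add_left (f := fun ω => gain k c (Z ω)) (by fun_prop)]
    exact ENNReal.add_ne_top.2 ⟨hgain, ne_top_of_le_ne_top hloss
      (lintegral_mono fun ω => loss_anti k c (hZε ω))⟩
  have heq := ae_eq_of_ae_le_of_lintegral_le (g := fun ω => gain k c (Z ω + ε) + loss k c (Z ω))
    (ae_of_all _ fun ω => add_le_add (gain_mono k c (hZε ω)) (loss_anti k c (hZε ω))) hfin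
    (by fun_prop) (by
      rwa [lintegral_add_left (f := fun ω => gain k c (Z ω + ε)) (by fun_prop),
        lintegral_add_left (f := fun ω => gain k c (Z ω)) (by fun_prop)])
  filter_upwards [heq, ae_lt_top (by fun_prop) hfin] with ω hω hlt y hy
  rw [gain_add_loss_eq k c (hZε ω)] at hω
  refine eq_zero_of_setLIntegral_Icc_eq_zero hk ?_ (by exact_mod_cast hy)
  exact (ENNReal.add_right_inj hlt.ne).1 (hω.symm.trans (add_zero _).symm)

theorem tendsto_lintegral_gain_min (hY : Measurable Y) (k : ℝ → ℝ≥0∞) (c : ℝ≥0) :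
    Filter.Tendsto (fun n : ℕ => ∫⁻ ω, gain k c (min (Y ω) n) ∂P) Filter.atTop
      (nhds (∫⁻ ω, gain k c (Y ω) ∂P)) := by
  have hgm : Measurable (gain k c) := measurable_gain k c
  refine lintegral_tendsto_of_tendsto_of_monotone (fun n => by fun_prop)
    (ae_of_all _ fun ω m n hmn => gain_mono k c (min_le_min_left _ (Nat.cast_le.2 hmn)))
    (ae_of_all _ fun ω => tendsto_const_nhds.congr' ?_)
  obtain ⟨m, hm⟩ := exists_nat_ge (Y ω)
  filter_upwards [Filter.eventually_ge_atTop m] with n hn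
  rw [min_eq_left (hm.trans (Nat.cast_le.2 hn))]

theorem exists_lintegral_gain_add_loss_min_lt (hY : Measurable Y)
    (hlt : ∫⁻ ω, gain k c (Z ω) ∂P + ∫⁻ ω, loss k c (Y ω) ∂P
      < ∫⁻ ω, gain k c (Y ω) ∂P + ∫⁻ ω, loss k c (Z ω) ∂P) :
    ∃ n : ℕ, ∫⁻ ω, gain k c (Z ω) ∂P + ∫⁻ ω, loss k c (min (Y ω) n) ∂P
      < ∫⁻ ω, gain k c (min (Y ω) n) ∂P + ∫⁻ ω, loss k c (Z ω) ∂P := by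
  have hlim := (tendsto_lintegral_gain_min (P := P) hY k c).add_const (∫⁻ ω, loss k c (Z ω) ∂P)
  obtain ⟨m, hm⟩ := exists_nat_ge c
  obtain ⟨n, hn, hmn⟩ :=
    ((hlim.eventually (lt_mem_nhds hlt)).and (Filter.eventually_ge_atTop m)).exists
  refine ⟨n, lt_of_le_of_lt ?_ hn⟩
  gcongr _ + ∫⁻ ω, ?_ ∂P with ω
  rcases le_total (Y ω) n with hYn | hYn
  · rw [min_eq_left hYn]
  · rw [min_eq_right hYn, loss_eq_zero k (hm.trans (Nat.cast_le.2 hmn))]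
    exact zero_le

end Optimality

namespace Market

/-! ### Payoffs, prices and state prices -/

section StatePrice

variable {Ω : Type*} [MeasurableSpace Ω] {M : Market Ω} {P : Measure Ω} {X Y : Ω → ℝ≥0}

theorem mem_payoffs_iff : X ∈ M.payoffs ↔ Measurable X ∧ ∫⁻ ω, X ω ∂M.Q ≠ ⊤ := by
  have hS : Measurable M.S := measurable_iff_comap_le.2 M.sigma_eq.ge
  have hfactor : (∃ g : ℝ≥0 → ℝ≥0, Measurable g ∧ X = fun ω => g (M.S ω)) ↔ Measurable X := by
    refine ⟨fun ⟨g, hg, hXg⟩ => hXg ▸ hg.comp hS, fun hX => ?_⟩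
    have hX' : Measurable[MeasurableSpace.comap M.S inferInstance] X :=
      hX.mono M.sigma_eq.le le_rfl
    exact hX'.exists_eq_measurable_comp
  rw [payoffs, Set.mem_ofPred_eq, hfactor]
  refine and_congr_right fun hX => ?_
  rw [Integrable, and_iff_right (by fun_prop), hasFiniteIntegral_iff_enorm, lt_top_iff_ne_top]
  simp

theorem measurable_lik (P : Measure Ω) : Measurable (M.lik P) :=
  ENNReal.measurable_toNNReal.comp (Measure.measurable_rnDeriv _ _)

theorem measurable_statePrice (P : Measure Ω) : Measurable (M.statePrice P) :=
  measurable_const.div (measurable_lik P)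

theorem coe_lik_ae (hP : P ∈ M.models) : ∀ᵐ ω ∂M.Q, (M.lik P ω : ℝ≥0∞) = P.rnDeriv M.Q ω := by
  have := M.isProb P hP
  exact (P.rnDeriv_lt_top M.Q).mono fun ω hω => ENNReal.coe_toNNReal hω.ne

theorem ae_lik_pos (hP : P ∈ M.models) : ∀ᵐ ω ∂P, 0 < M.lik P ω := by
  have := M.isProb P hP
  have := M.isProb_Q
  filter_upwards [Measure.rnDeriv_pos (M.equiv P hP).1,
    (M.equiv P hP).1.ae_le (coe_lik_ae hP)] with ω hpos hlik
  rwa [← hlik, ENNReal.coe_pos] at hpos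

theorem lintegral_eq_lintegral_lik (hP : P ∈ M.models) {f : Ω → ℝ≥0∞} (hf : Measurable f) :
    ∫⁻ ω, f ω ∂P = ∫⁻ ω, M.lik P ω * f ω ∂M.Q := by
  have := M.isProb P hP
  have := M.isProb_Q
  rw [← lintegral_rnDeriv_mul (M.equiv P hP).1 hf.aemeasurable]
  exact lintegral_congr_ae ((coe_lik_ae hP).mono fun ω hω => by simp only [hω])

theorem lintegral_statePrice_mul (hP : P ∈ M.models) (hX : Measurable X) :
    ∫⁻ ω, M.statePrice P ω * X ω ∂P
      = ENNReal.ofReal (Real.exp (-(M.r * M.T))) * ∫⁻ ω, X ω ∂M.Q := by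
  have hξ : Measurable (M.statePrice P) := measurable_statePrice P
  rw [lintegral_eq_lintegral_lik hP (by fun_prop), ← lintegral_const_mul _ (by fun_prop)]
  refine lintegral_congr_ae ?_
  filter_upwards [(M.equiv P hP).2.ae_le (ae_lik_pos hP)] with ω hω
  have hcancel : M.lik P ω * (M.statePrice P ω * X ω)
      = (Real.exp (-(M.r * M.T))).toNNReal * X ω := by
    rw [statePrice]; field_simp
  rw [ENNReal.ofReal]
  exact_mod_cast hcancel

theorem mem_payoffs_iff_lintegral_statePrice_mul (hP : P ∈ M.models) :
    X ∈ M.payoffs ↔ Measurable X ∧ ∫⁻ ω, M.statePrice P ω * X ω ∂P ≠ ⊤ := by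
  rw [mem_payoffs_iff]
  refine and_congr_right fun hX => ?_
  rw [lintegral_statePrice_mul hP hX, ne_eq, ne_eq, ENNReal.mul_eq_top]
  simp [Real.exp_pos]

theorem lintegral_statePrice_ne_top (hP : P ∈ M.models) : ∫⁻ ω, M.statePrice P ω ∂P ≠ ⊤ := by
  have := M.isProb_Q
  have h := lintegral_statePrice_mul (X := fun _ => 1) hP measurable_const
  simp only [ENNReal.coe_one, mul_one, lintegral_const, measure_univ] at h
  exact h.trans_ne ENNReal.ofReal_ne_top

theorem ofReal_price (hP : P ∈ M.models) (hX : X ∈ M.payoffs) :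
    ENNReal.ofReal (M.price X) = ∫⁻ ω, M.statePrice P ω * X ω ∂P := by
  rw [lintegral_statePrice_mul hP (mem_payoffs_iff.1 hX).1, price,
    ENNReal.ofReal_mul (Real.exp_pos _).le,
    ofReal_integral_eq_lintegral_ofReal hX.2 (ae_of_all _ fun ω => (X ω).2)]
  simp

theorem price_nonneg (X : Ω → ℝ≥0) : 0 ≤ M.price X :=
  mul_nonneg (Real.exp_pos _).le (integral_nonneg fun ω => (X ω).2)

theorem price_le_iff (hP : P ∈ M.models) (hX : X ∈ M.payoffs) (hY : Y ∈ M.payoffs) :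
    M.price X ≤ M.price Y ↔
      ∫⁻ ω, M.statePrice P ω * X ω ∂P ≤ ∫⁻ ω, M.statePrice P ω * Y ω ∂P := by
  rw [← ofReal_price hP hX, ← ofReal_price hP hY,
    ENNReal.ofReal_le_ofReal_iff (price_nonneg Y)]

theorem ae_lik_ne (hP : P ∈ M.models) (hcont : Continuous (distFun (law P (M.lik P))))
    (s : ℝ≥0) : ∀ᵐ ω ∂P, M.lik P ω ≠ s := by
  have := M.isProb P hP
  have := isProbabilityMeasure_law (P := P) (measurable_lik (M := M) P)
  have := nullSingletonClass_of_continuous_distFun hcont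
  exact ae_of_ae_map (measurable_lik P).aemeasurable (Measure.ae_ne (law P (M.lik P)) s)

theorem ae_statePrice_ne (hP : P ∈ M.models) (hcont : Continuous (distFun (law P (M.lik P))))
    (s : ℝ≥0) : ∀ᵐ ω ∂P, M.statePrice P ω ≠ s := by
  filter_upwards [ae_lik_ne hP hcont ((Real.exp (-(M.r * M.T))).toNNReal / s)]
    with ω hne
  rintro rfl
  refine hne ?_
  have hd : (Real.exp (-(M.r * M.T))).toNNReal ≠ 0 := (Real.toNNReal_pos.2 (Real.exp_pos _)).ne'
  rw [statePrice, div_div_cancel₀ hd]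

theorem ae_distFun_statePrice (hP : P ∈ M.models)
    (hcont : Continuous (distFun (law P (M.lik P)))) :
    ∀ᵐ ω ∂P, distFun (law P (M.statePrice P)) (M.statePrice P ω)
      = 1 - distFun (law P (M.lik P)) (M.lik P ω) := by
  have := M.isProb P hP
  have hd : 0 < (Real.exp (-(M.r * M.T))).toNNReal := Real.toNNReal_pos.2 (Real.exp_pos _)
  have hdist : ∀ {V : Ω → ℝ≥0}, Measurable V → ∀ x : ℝ≥0,
      distFun (law P V) x = P.real {ω | V ω ≤ x} := fun hV x => by
    rw [measureReal_def, ← ENNReal.toReal_ofReal (distFun_nonneg _ x), ofReal_distFun_law hV]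
    rfl
  filter_upwards [ae_lik_pos hP] with ω hω
  rw [hdist (measurable_statePrice P), hdist (measurable_lik P),
    ← probReal_compl_eq_one_sub (measurableSet_le (measurable_lik P) measurable_const)]
  refine measureReal_congr ?_
  filter_upwards [ae_lik_pos hP, ae_lik_ne hP hcont (M.lik P ω)] with ω' hpos hne
  refine propext ?_
  change M.statePrice P ω' ≤ M.statePrice P ω ↔ ¬ M.lik P ω' ≤ M.lik P ω
  rw [statePrice, statePrice, div_le_div_iff_of_pos_left hd hpos hω, not_le]
  exact hne.symm.le_iff_lt

theorem price_congr (hP : P ∈ M.models) (h : X =ᵐ[P] Y) : M.price X = M.price Y := by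
  rw [price, price,
    integral_congr_ae (((M.equiv P hP).2.ae_eq h).mono fun ω hω => congrArg NNReal.toReal hω)]

theorem absolutelyContinuous_of_mem_models {P' : Measure Ω} (hP : P ∈ M.models)
    (hP' : P' ∈ M.models) : P ≪ P' :=
  (M.equiv P hP).1.trans (M.equiv P' hP').2

end StatePrice

/-! ### Cost-efficient payoffs -/

section CostEfficiency

variable {Ω : Type*} [MeasurableSpace Ω] {M : Market Ω} {P : Measure Ω} {X Y : Ω → ℝ≥0}
  {c : ℝ≥0} {𝔽 : Set (ℝ≥0 → ℝ)}

/-- The payoff `F_X⁻¹(F_ℓ(ℓ))`, which has the distribution of `X` under `P` and is nondecreasing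
in the likelihood ratio `ℓ` of `P`. -/
noncomputable def efficient (M : Market Ω) (P : Measure Ω) (X : Ω → ℝ≥0) (ω : Ω) : ℝ≥0 :=
  transport (law P (M.lik P)) (law P X) (M.lik P ω)

/-- The marginal utility `y ↦ F_ξ⁻¹(1 - F_X(y))`, where `ξ` is the state price of `P`. -/
noncomputable def marginal (M : Market Ω) (P : Measure Ω) (X : Ω → ℝ≥0) (y : ℝ) : ℝ≥0∞ :=
  quantile (law P (M.statePrice P)) (1 - distFun (law P X) y)

theorem measurable_efficient (P : Measure Ω) (X : Ω → ℝ≥0) : Measurable (M.efficient P X) :=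
  (measurable_transport _ _).comp (measurable_lik P)

theorem law_efficient (hP : P ∈ M.models) (hcont : Continuous (distFun (law P (M.lik P))))
    (hX : Measurable X) : law P (M.efficient P X) = law P X :=
  have := M.isProb P hP
  law_transport_comp (measurable_lik P) hX hcont

theorem lintegral_comp_efficient (hP : P ∈ M.models)
    (hcont : Continuous (distFun (law P (M.lik P)))) (hX : Measurable X) {f : ℝ≥0 → ℝ≥0∞}
    (hf : Measurable f) : ∫⁻ ω, f (M.efficient P X ω) ∂P = ∫⁻ ω, f (X ω) ∂P :=
  lintegral_comp_eq_of_law_eq (measurable_efficient P X) hX (law_efficient hP hcont hX) hf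

theorem antitone_marginal (P : Measure Ω) (X : Ω → ℝ≥0) : Antitone (M.marginal P X) :=
  fun _ _ h => quantile_mono _ (sub_le_sub_left (distFun_mono _ h) 1)

theorem marginal_ne_top (hc : 0 < distFun (law P X) c) : M.marginal P X c ≠ ⊤ :=
  quantile_ne_top (sub_lt_self 1 hc)

theorem one_le_distFun_of_marginal_eq_zero (hP : P ∈ M.models)
    (hcont : Continuous (distFun (law P (M.lik P)))) {y : ℝ} (hy : M.marginal P X y = 0) :
    1 ≤ distFun (law P X) y := by
  have := M.isProb P hP
  have hzero : distFun (law P (M.statePrice P)) (0 : ℝ≥0) ≤ 0 := by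
    rw [← ENNReal.ofReal_eq_zero, ofReal_distFun_law (measurable_statePrice P)]
    simpa only [ae_iff, not_not, NNReal.coe_le_coe, nonpos_iff_eq_zero]
      using ae_statePrice_ne hP hcont 0
  have hle := (quantile_le_iff (x := 0)).1 (hy.le.trans_eq ENNReal.coe_zero.symm)
  linarith

theorem marginal_le_statePrice_iff (hP : P ∈ M.models)
    (hcont : Continuous (distFun (law P (M.lik P)))) (X : Ω → ℝ≥0) :
    ∀ᵐ ω ∂P, ∀ y : ℝ, M.marginal P X y ≤ M.statePrice P ω ↔
      distFun (law P (M.lik P)) (M.lik P ω) ≤ distFun (law P X) y := by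
  filter_upwards [ae_distFun_statePrice hP hcont] with ω hω y
  rw [marginal, quantile_le_iff, hω, sub_le_sub_iff_left]

theorem isStrictSupergradient_statePrice (hP : P ∈ M.models)
    (hcont : Continuous (distFun (law P (M.lik P)))) (hX : Measurable X) :
    ∀ᵐ ω ∂P, IsStrictSupergradient (M.marginal P X) (M.statePrice P ω) (M.efficient P X ω) := by
  have := M.isProb P hP
  have := isProbabilityMeasure_law (P := P) hX
  -- An antitone function that is nowhere equal to `s` at rational points attains `s` at most once.
  have hrat : ∀ᵐ ω ∂P, ∀ q : ℚ, M.marginal P X q ≠ M.statePrice P ω := ae_all_iff.2 fun q => by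
    by_cases hq : M.marginal P X q = ⊤
    · simp [hq]
    · filter_upwards [ae_statePrice_ne hP hcont (M.marginal P X q).toNNReal] with ω hω h
      exact hω (by rw [h, ENNReal.toNNReal_coe])
  filter_upwards [ae_distFun_law_mem_Ioo (measurable_lik P) hcont,
    marginal_le_statePrice_iff hP hcont X, hrat] with ω hIoo hiff hne
  have hle : ∀ y : ℝ, M.efficient P X ω < y → M.marginal P X y ≤ M.statePrice P ω := fun y hy => by
    lift y to ℝ≥0 using (NNReal.coe_nonneg _).trans hy.le
    exact (hiff y).2 ((transport_le_iff hIoo.2).1 (NNReal.coe_lt_coe.1 hy).le)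
  refine ⟨fun y hy => lt_of_not_ge fun h => ?_, fun y hy => ?_⟩
  · have hdist := (hiff y).1 h
    rcases lt_or_ge y 0 with hneg | hpos
    · rw [distFun_of_neg hneg] at hdist
      exact hIoo.1.not_ge hdist
    · lift y to ℝ≥0 using hpos
      exact (NNReal.coe_lt_coe.1 hy).not_ge ((transport_le_iff hIoo.2).2 hdist)
  · obtain ⟨q, hEq, hqy⟩ := exists_rat_btwn hy
    exact (antitone_marginal P X hqy.le).trans_lt ((hle q hEq).lt_of_ne (hne q))

theorem ae_isSupergradient_statePrice (hP : P ∈ M.models)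
    (hcont : Continuous (distFun (law P (M.lik P)))) (hX : Measurable X) :
    ∀ᵐ ω ∂P, IsSupergradient (M.marginal P X) (M.statePrice P ω) (M.efficient P X ω) :=
  (isStrictSupergradient_statePrice hP hcont hX).mono fun _ h => h.isSupergradient

theorem lintegral_gain_payoff_ne_top (hP : P ∈ M.models)
    (hcont : Continuous (distFun (law P (M.lik P)))) (hX : Measurable X)
    (hgain : ∫⁻ ω, gain (M.marginal P X) c (X ω) ∂P ≠ ⊤) (hY : Y ∈ M.payoffs) :
    ∫⁻ ω, gain (M.marginal P X) c (Y ω) ∂P ≠ ⊤ :=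
  lintegral_gain_ne_top (measurable_efficient P X) (ae_isSupergradient_statePrice hP hcont hX)
    ((lintegral_comp_efficient hP hcont hX (measurable_gain _ c)).trans_ne hgain)
    ((mem_payoffs_iff_lintegral_statePrice_mul hP).1 hY).2

theorem lintegral_loss_self_ne_top (hP : P ∈ M.models)
    (hcont : Continuous (distFun (law P (M.lik P)))) (hX : Measurable X) (c : ℝ≥0) :
    ∫⁻ ω, loss (M.marginal P X) c (X ω) ∂P ≠ ⊤ := by
  rw [← lintegral_comp_efficient hP hcont hX (measurable_loss _ c)]
  exact lintegral_loss_ne_top (lintegral_statePrice_ne_top hP)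
    (ae_isSupergradient_statePrice hP hcont hX) c

theorem lintegral_statePrice_mul_efficient_le (hP : P ∈ M.models)
    (hcont : Continuous (distFun (law P (M.lik P)))) (hX : Measurable X)
    (hc : 0 < distFun (law P X) c) (hgain : ∫⁻ ω, gain (M.marginal P X) c (X ω) ∂P ≠ ⊤)
    (hY : Y ∈ M.payoffs) (hXY : IntegralOrder SSD (law P X) (law P Y)) :
    ∫⁻ ω, M.statePrice P ω * M.efficient P X ω ∂P ≤ ∫⁻ ω, M.statePrice P ω * Y ω ∂P := by
  have := M.isProb P hP
  have hXp := isProbabilityMeasure_law (P := P) hX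
  have hYm := (mem_payoffs_iff.1 hY).1
  have hYp := isProbabilityMeasure_law (P := P) hYm
  have hgm := measurable_gain (M.marginal P X) c
  have hlm := measurable_loss (M.marginal P X) c
  have hgY := lintegral_gain_payoff_ne_top hP hcont hX hgain hY
  have horder := lintegral_gain_add_loss_le hXY (antitone_marginal P X) (marginal_ne_top hc)
    (by rwa [lintegral_law hX hgm]) (by rwa [lintegral_law hYm hgm])
  rw [lintegral_law hX hgm, lintegral_law hX hlm, lintegral_law hYm hgm, lintegral_law hYm hlm,
    ← lintegral_comp_efficient hP hcont hX hgm, ← lintegral_comp_efficient hP hcont hX hlm]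
    at horder
  refine cost_le_of_lintegral_gain_add_loss_le (measurable_statePrice P) hYm
    (measurable_efficient P X) (ae_isSupergradient_statePrice hP hcont hX) hgY ?_ horder
  rw [lintegral_comp_efficient hP hcont hX hlm]
  exact lintegral_loss_self_ne_top hP hcont hX c

end CostEfficiency

section Characterization

variable {Ω : Type*} [MeasurableSpace Ω] {M : Market Ω} {P : Measure Ω} {X Y : Ω → ℝ≥0}
  {c : ℝ≥0} {𝔽 : Set (ℝ≥0 → ℝ)}

theorem efficient_mem_payoffs (hP : P ∈ M.models) (hcont : Continuous (distFun (law P (M.lik P))))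
    (hX : X ∈ M.payoffs) (hc : 0 < distFun (law P X) c)
    (hgain : ∫⁻ ω, gain (M.marginal P X) c (X ω) ∂P ≠ ⊤) : M.efficient P X ∈ M.payoffs :=
  (mem_payoffs_iff_lintegral_statePrice_mul hP).2 ⟨measurable_efficient P X,
    ne_top_of_le_ne_top ((mem_payoffs_iff_lintegral_statePrice_mul hP).1 hX).2
      (lintegral_statePrice_mul_efficient_le hP hcont (mem_payoffs_iff.1 hX).1 hc hgain hX
        fun _ _ _ _ => le_rfl)⟩

theorem price_efficient_le (hP : P ∈ M.models) (hcont : Continuous (distFun (law P (M.lik P))))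
    (hX : X ∈ M.payoffs) (hc : 0 < distFun (law P X) c)
    (hgain : ∫⁻ ω, gain (M.marginal P X) c (X ω) ∂P ≠ ⊤) (hY : Y ∈ M.payoffs)
    (hXY : IntegralOrder SSD (law P X) (law P Y)) : M.price (M.efficient P X) ≤ M.price Y :=
  (price_le_iff hP (efficient_mem_payoffs hP hcont hX hc hgain) hY).2
    (lintegral_statePrice_mul_efficient_le hP hcont (mem_payoffs_iff.1 hX).1 hc hgain hY hXY)

theorem ae_eq_efficient_of_price_le (hP : P ∈ M.models)
    (hcont : Continuous (distFun (law P (M.lik P)))) (hX : X ∈ M.payoffs)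
    (hc : 0 < distFun (law P X) c) (hgain : ∫⁻ ω, gain (M.marginal P X) c (X ω) ∂P ≠ ⊤)
    (hY : Y ∈ M.payoffs) (hprice : M.price Y ≤ M.price (M.efficient P X))
    (hle : ∫⁻ ω, gain (M.marginal P X) c (X ω) ∂P + ∫⁻ ω, loss (M.marginal P X) c (Y ω) ∂P
      ≤ ∫⁻ ω, gain (M.marginal P X) c (Y ω) ∂P + ∫⁻ ω, loss (M.marginal P X) c (X ω) ∂P) :
    Y =ᵐ[P] M.efficient P X := by
  have hXm := (mem_payoffs_iff.1 hX).1
  have hE := efficient_mem_payoffs hP hcont hX hc hgain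
  have hgainE := lintegral_comp_efficient hP hcont hXm (measurable_gain (M.marginal P X) c)
  have hlossE := lintegral_comp_efficient hP hcont hXm (measurable_loss (M.marginal P X) c)
  exact ae_eq_of_cost_le_of_lintegral_gain_add_loss_le (measurable_statePrice P)
    (mem_payoffs_iff.1 hY).1 (measurable_efficient P X) (antitone_marginal P X).measurable
    (isStrictSupergradient_statePrice hP hcont hXm)
    ((mem_payoffs_iff_lintegral_statePrice_mul hP).1 hE).2
    (lintegral_gain_payoff_ne_top hP hcont hXm hgain hY) (hgainE.trans_ne hgain)
    (hlossE.trans_ne (lintegral_loss_self_ne_top hP hcont hXm c))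
    ((price_le_iff hP hY hE).1 hprice) (by rwa [hgainE, hlossE])

theorem price_le_price_efficient_iff (hP : P ∈ M.models)
    (hcont : Continuous (distFun (law P (M.lik P)))) (hX : X ∈ M.payoffs)
    (hc : 0 < distFun (law P X) c) (hgain : ∫⁻ ω, gain (M.marginal P X) c (X ω) ∂P ≠ ⊤) :
    M.price X ≤ M.price (M.efficient P X) ↔ X =ᵐ[P] M.efficient P X :=
  ⟨fun h => ae_eq_efficient_of_price_le hP hcont hX hc hgain hX h le_rfl,
    fun h => (price_congr hP h).le⟩

theorem costEfficient_iff (hP : P ∈ M.models) (hcont : Continuous (distFun (law P (M.lik P))))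
    (hX : X ∈ M.payoffs) (hc : 0 < distFun (law P X) c)
    (hgain : ∫⁻ ω, gain (M.marginal P X) c (X ω) ∂P ≠ ⊤) :
    M.CostEfficient P X ↔ X =ᵐ[P] M.efficient P X := by
  rw [← price_le_price_efficient_iff hP hcont hX hc hgain]
  refine ⟨fun h => h.2 _ ⟨efficient_mem_payoffs hP hcont hX hc hgain,
    law_efficient hP hcont (mem_payoffs_iff.1 hX).1⟩, fun h => ⟨⟨hX, rfl⟩, fun Y hY => ?_⟩⟩
  refine h.trans (price_efficient_le hP hcont hX hc hgain hY.1 ?_)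
  rw [hY.2]
  exact fun _ _ _ _ => le_rfl

theorem nondecreasingInLik_iff (hP : P ∈ M.models)
    (hcont : Continuous (distFun (law P (M.lik P)))) (hX : Measurable X) :
    M.NondecreasingInLik P X ↔ X =ᵐ[P] M.efficient P X :=
  have := M.isProb P hP
  nondecreasingIn_iff_ae_eq_transport (measurable_lik P) hX hcont

theorem ae_eq_quantile_iff (hP : P ∈ M.models) (hcont : Continuous (distFun (law P (M.lik P))))
    (X : Ω → ℝ≥0) :
    (∀ᵐ ω ∂P, (X ω : ℝ≥0∞) = quantile (law P X) (distFun (law P (M.lik P)) (M.lik P ω))) ↔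
      X =ᵐ[P] M.efficient P X := by
  have := M.isProb P hP
  refine Filter.eventually_congr ?_
  filter_upwards [ae_distFun_law_mem_Ioo (measurable_lik P) hcont] with ω hω
  rw [efficient, ← coe_transport hω.2, ENNReal.coe_inj]

theorem robustCostEfficient_iff (hP : P ∈ M.models)
    (hcont : Continuous (distFun (law P (M.lik P)))) (hX : X ∈ M.payoffs)
    (hc : 0 < distFun (law P X) c) (hgain : ∫⁻ ω, gain (M.marginal P X) c (X ω) ∂P ≠ ⊤)
    (hSSD : SSD ⊆ 𝔽)
    (horder : ∀ P' ∈ M.models, IntegralOrder 𝔽 (law P X) (law P' (M.efficient P X))) :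
    M.RobustCostEfficient 𝔽 (law P X) X ↔ X =ᵐ[P] M.efficient P X := by
  refine ⟨fun h => (price_le_price_efficient_iff hP hcont hX hc hgain).1
    (h.2 _ ⟨efficient_mem_payoffs hP hcont hX hc hgain, horder⟩), fun h => ⟨⟨hX, ?_⟩, ?_⟩⟩
  · intro P' hP'
    rw [law_congr ((absolutelyContinuous_of_mem_models hP' hP).ae_eq h)]
    exact horder P' hP'
  · rintro Y ⟨hY, hXY⟩
    rw [price_congr hP h]
    exact price_efficient_le hP hcont hX hc hgain hY ((hXY P hP).mono hSSD)

theorem ae_eq_efficient_of_ae_one_le_distFun (hP : P ∈ M.models)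
    (hcont : Continuous (distFun (law P (M.lik P)))) (hX : Measurable X)
    (h : ∀ᵐ ω ∂P, 1 ≤ distFun (law P X) (X ω)) : X =ᵐ[P] M.efficient P X := by
  have := M.isProb P hP
  refine (ae_eq_of_ae_le_of_law_eq (measurable_efficient P X) hX ?_
    (law_efficient hP hcont hX)).symm
  filter_upwards [h, ae_distFun_law_mem_Ioo (measurable_lik P) hcont] with ω hω hIoo
  exact (transport_le_iff hIoo.2).2 ((distFun_le_one _ _).trans hω)

theorem ae_eq_efficient_of_lintegral_gain_add_loss_le (hP : P ∈ M.models)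
    (hcont : Continuous (distFun (law P (M.lik P)))) (hX : Measurable X)
    (hgain : ∫⁻ ω, gain (M.marginal P X) c (X ω) ∂P ≠ ⊤) {ε : ℝ≥0} (hε : 0 < ε)
    (hle : ∫⁻ ω, gain (M.marginal P X) c (M.efficient P X ω + ε) ∂P
        + ∫⁻ ω, loss (M.marginal P X) c (X ω) ∂P
      ≤ ∫⁻ ω, gain (M.marginal P X) c (X ω) ∂P
        + ∫⁻ ω, loss (M.marginal P X) c (M.efficient P X ω + ε) ∂P) :
    X =ᵐ[P] M.efficient P X := by
  have hgainE := lintegral_comp_efficient hP hcont hX (measurable_gain (M.marginal P X) c)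
  have hlossE := lintegral_comp_efficient hP hcont hX (measurable_loss (M.marginal P X) c)
  have hzero := ae_eq_zero_of_lintegral_gain_add_loss_le (measurable_efficient P X)
    (antitone_marginal P X) (hgainE.trans_ne hgain)
    (hlossE.trans_ne (lintegral_loss_self_ne_top hP hcont hX c)) ε (by rwa [hgainE, hlossE])
  have hone : ∀ᵐ ω ∂P, 1 ≤ distFun (law P X) (M.efficient P X ω) := by
    filter_upwards [hzero] with ω hω
    refine le_distFun_of_forall_gt fun y hy => ?_
    have hmin : min y (M.efficient P X ω + ε)
        ∈ Set.Ioc (M.efficient P X ω : ℝ) (M.efficient P X ω + ε) :=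
      ⟨lt_min hy (lt_add_of_pos_right _ hε), min_le_right _ _⟩
    exact (one_le_distFun_of_marginal_eq_zero hP hcont (hω _ hmin)).trans
      (distFun_mono _ (min_le_left _ _))
  have hset : MeasurableSet {x : ℝ≥0 | 1 ≤ distFun (law P X) x} :=
    measurableSet_le measurable_const ((distFun_mono _).measurable.comp (by fun_prop))
  have hlaw : ∀ᵐ x : ℝ≥0 ∂law P (M.efficient P X), 1 ≤ distFun (law P X) x :=
    (ae_map_iff (measurable_efficient P X).aemeasurable hset).2 hone
  rw [law_efficient hP hcont hX] at hlaw
  exact ae_eq_efficient_of_ae_one_le_distFun hP hcont hX (ae_of_ae_map hX.aemeasurable hlaw)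

theorem exists_price_add_le (hP : P ∈ M.models) (hY : Y ∈ M.payoffs)
    (hX : X ∈ M.payoffs) (hlt : M.price Y < M.price X) :
    ∃ ε : ℝ≥0, 0 < ε ∧ (fun ω => Y ω + ε) ∈ M.payoffs ∧
      M.price (fun ω => Y ω + ε) ≤ M.price X := by
  have hYm := (mem_payoffs_iff.1 hY).1
  have hcost := lt_of_not_ge fun h => hlt.not_ge ((price_le_iff hP hX hY).2 h)
  obtain ⟨ε, hε, hε_lt⟩ := ENNReal.exists_nnreal_pos_mul_lt (lintegral_statePrice_ne_top hP)
    (tsub_pos_of_lt hcost).ne'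
  have hle : ∫⁻ ω, M.statePrice P ω * (Y ω + ε : ℝ≥0) ∂P ≤ ∫⁻ ω, M.statePrice P ω * X ω ∂P := by
    have hξ : Measurable (M.statePrice P) := measurable_statePrice P
    simp only [ENNReal.coe_add, mul_add]
    rw [lintegral_add_left (by fun_prop), lintegral_mul_const _ (by fun_prop),
      mul_comm _ (ε : ℝ≥0∞)]
    calc _ ≤ _ + _ := by gcongr
      _ = _ := add_tsub_cancel_of_le hcost.le
  have hmem : (fun ω => Y ω + ε) ∈ M.payoffs := (mem_payoffs_iff_lintegral_statePrice_mul hP).2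
    ⟨by fun_prop, ne_top_of_le_ne_top ((mem_payoffs_iff_lintegral_statePrice_mul hP).1 hX).2 hle⟩
  exact ⟨ε, hε, hmem, (price_le_iff hP hmem hX).2 hle⟩

theorem exists_monotone_comp_efficient_gain_add_loss_lt (hP : P ∈ M.models)
    (hcont : Continuous (distFun (law P (M.lik P)))) (hX : X ∈ M.payoffs)
    (hc : 0 < distFun (law P X) c) (hgain : ∫⁻ ω, gain (M.marginal P X) c (X ω) ∂P ≠ ⊤)
    (hne : ¬ X =ᵐ[P] M.efficient P X) :
    ∃ φ : ℝ≥0 → ℝ≥0, Monotone φ ∧ (∃ b, ∀ x, φ x ≤ b) ∧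
      (fun ω => φ (M.efficient P X ω)) ∈ M.payoffs ∧
      M.price (fun ω => φ (M.efficient P X ω)) ≤ M.price X ∧
      ∫⁻ ω, gain (M.marginal P X) c (X ω) ∂P
          + ∫⁻ ω, loss (M.marginal P X) c (φ (M.efficient P X ω)) ∂P
        < ∫⁻ ω, gain (M.marginal P X) c (φ (M.efficient P X ω)) ∂P
          + ∫⁻ ω, loss (M.marginal P X) c (X ω) ∂P := by
  have hXm := (mem_payoffs_iff.1 hX).1
  have hEm : Measurable (M.efficient P X) := measurable_efficient P X
  obtain ⟨ε, hε, hmem, hprice⟩ := exists_price_add_le hP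
    (efficient_mem_payoffs hP hcont hX hc hgain) hX
    (lt_of_not_ge fun h => hne ((price_le_price_efficient_iff hP hcont hX hc hgain).1 h))
  obtain ⟨n, hn⟩ := exists_lintegral_gain_add_loss_min_lt (hEm.add_const ε) (lt_of_not_ge fun h =>
    hne (ae_eq_efficient_of_lintegral_gain_add_loss_le hP hcont hXm hgain hε h))
  have hle : ∀ ω, min (M.efficient P X ω + ε) n ≤ M.efficient P X ω + ε := fun ω => min_le_left _ _
  have hcost : ∫⁻ ω, M.statePrice P ω * (min (M.efficient P X ω + ε) n : ℝ≥0) ∂P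
      ≤ ∫⁻ ω, M.statePrice P ω * (M.efficient P X ω + ε : ℝ≥0) ∂P := by
    gcongr with ω
    exact hle ω
  have hZ : (fun ω => min (M.efficient P X ω + ε) (n : ℝ≥0)) ∈ M.payoffs :=
    (mem_payoffs_iff_lintegral_statePrice_mul hP).2 ⟨by fun_prop, ne_top_of_le_ne_top
      ((mem_payoffs_iff_lintegral_statePrice_mul hP).1 hmem).2 hcost⟩
  exact ⟨fun x => min (x + ε) n, fun x y hxy => min_le_min_right _ (add_le_add_left hxy ε),
    ⟨n, fun x => min_le_right _ _⟩, hZ, ((price_le_iff hP hZ hmem).2 hcost).trans hprice, hn⟩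

end Characterization

end Market

/-! ### Expected utility -/

section EReal

variable {a b a' b' : ℝ≥0∞}

theorem ereal_coe_sub_coe_eq_bot_iff : (a : EReal) - b = ⊥ ↔ b = ⊤ := by
  rw [sub_eq_add_neg, EReal.add_eq_bot_iff, EReal.neg_eq_bot_iff]
  simp

theorem ereal_coe_sub_coe_eq_top_iff (hb : b ≠ ⊤) : (a : EReal) - b = ⊤ ↔ a = ⊤ := by
  rw [← top_le_iff, EReal.le_sub_iff_add_le (.inl (EReal.coe_ennreal_ne_bot b))
    (.inl (EReal.coe_ennreal_eq_top_iff.not.2 hb)), EReal.top_add_of_ne_bot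
    (EReal.coe_ennreal_ne_bot b), top_le_iff, EReal.coe_ennreal_eq_top_iff]

theorem ereal_coe_sub_coe_le_iff (hb' : b' ≠ ⊤) :
    (a : EReal) - b ≤ a' - b' ↔ a + b' ≤ a' + b := by
  rw [EReal.sub_le_iff_le_add (.inl (EReal.coe_ennreal_ne_bot b))
      (.inr (ereal_coe_sub_coe_eq_bot_iff.not.2 hb')),
    sub_eq_add_neg, add_right_comm, ← sub_eq_add_neg,
    EReal.le_sub_iff_add_le (.inl (EReal.coe_ennreal_ne_bot b'))
      (.inl (EReal.coe_ennreal_eq_top_iff.not.2 hb')),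
    ← EReal.coe_ennreal_add, ← EReal.coe_ennreal_add, EReal.coe_ennreal_le_coe_ennreal_iff]

end EReal

namespace Market

section ExpectedUtility

variable {Ω : Type*} [MeasurableSpace Ω] {M : Market Ω} {P P' : Measure Ω} {X Y Z : Ω → ℝ≥0}
  {c : ℝ≥0}

theorem toENNReal_utility (M : Market Ω) (P : Measure Ω) (X : Ω → ℝ≥0) (c x : ℝ≥0) :
    (M.utility P X c x).toENNReal = gain (M.marginal P X) c x := by
  rw [utility]
  split_ifs with h
  · rw [EReal.toENNReal_coe]
    rfl
  · rw [gain_eq_zero _ (not_le.1 h).le, EReal.toENNReal_of_nonpos]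
    simpa using EReal.coe_ennreal_nonneg _

theorem toENNReal_neg_utility (M : Market Ω) (P : Measure Ω) (X : Ω → ℝ≥0) (c x : ℝ≥0) :
    (-M.utility P X c x).toENNReal = loss (M.marginal P X) c x := by
  rw [utility]
  split_ifs with h
  · rw [loss_eq_zero _ h, EReal.toENNReal_of_nonpos]
    simpa using EReal.coe_ennreal_nonneg _
  · rw [neg_neg, EReal.toENNReal_coe]
    rfl

theorem expectedUtility_eq (M : Market Ω) (P : Measure Ω) (X : Ω → ℝ≥0) (c : ℝ≥0)
    (P' : Measure Ω) (Y : Ω → ℝ≥0) :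
    expectedUtility (M.utility P X c) P' Y
      = ((∫⁻ ω, gain (M.marginal P X) c (Y ω) ∂P' : ℝ≥0∞) : EReal)
        - ((∫⁻ ω, loss (M.marginal P X) c (Y ω) ∂P' : ℝ≥0∞) : EReal) := by
  simp only [expectedUtility, toENNReal_utility, toENNReal_neg_utility]

theorem expectedUtility_le_iff
    (hloss : ∫⁻ ω, loss (M.marginal P X) c (Z ω) ∂P' ≠ ⊤) :
    expectedUtility (M.utility P X c) P Y ≤ expectedUtility (M.utility P X c) P' Z ↔
      ∫⁻ ω, gain (M.marginal P X) c (Y ω) ∂P + ∫⁻ ω, loss (M.marginal P X) c (Z ω) ∂P'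
        ≤ ∫⁻ ω, gain (M.marginal P X) c (Z ω) ∂P' + ∫⁻ ω, loss (M.marginal P X) c (Y ω) ∂P := by
  rw [expectedUtility_eq, expectedUtility_eq, ereal_coe_sub_coe_le_iff hloss]

theorem expectedUtility_eq_bot_iff :
    expectedUtility (M.utility P X c) P' Y = ⊥ ↔
      ∫⁻ ω, loss (M.marginal P X) c (Y ω) ∂P' = ⊤ := by
  rw [expectedUtility_eq, ereal_coe_sub_coe_eq_bot_iff]

theorem expectedUtility_eq_top_iff (hloss : ∫⁻ ω, loss (M.marginal P X) c (Y ω) ∂P' ≠ ⊤) :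
    expectedUtility (M.utility P X c) P' Y = ⊤ ↔
      ∫⁻ ω, gain (M.marginal P X) c (Y ω) ∂P' = ⊤ := by
  rw [expectedUtility_eq, ereal_coe_sub_coe_eq_top_iff hloss]

theorem expectedUtility_congr_law (hX : Measurable Y) (hY : Measurable Z)
    (h : law P' Y = law P' Z) :
    expectedUtility (M.utility P X c) P' Y = expectedUtility (M.utility P X c) P' Z := by
  rw [expectedUtility_eq, expectedUtility_eq,
    lintegral_comp_eq_of_law_eq hX hY h (measurable_gain _ c),
    lintegral_comp_eq_of_law_eq hX hY h (measurable_loss _ c)]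

theorem lintegral_loss_le_of_integralOrder (hP : P ∈ M.models) (hP' : P' ∈ M.models)
    (hY : Measurable Y) (h : IntegralOrder SSD (law P Y) (law P' Y)) :
    ∫⁻ ω, loss (M.marginal P X) c (Y ω) ∂P' ≤ ∫⁻ ω, loss (M.marginal P X) c (Y ω) ∂P := by
  have := M.isProb P hP
  have := M.isProb P' hP'
  have := isProbabilityMeasure_law (P := P) hY
  have := isProbabilityMeasure_law (P := P') hY
  rw [← lintegral_law hY (measurable_loss _ c), ← lintegral_law hY (measurable_loss _ c)]
  exact lintegral_loss_le h (antitone_marginal P X) c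

theorem expectedUtility_le_of_integralOrder (hP : P ∈ M.models) (hP' : P' ∈ M.models)
    (hcont : Continuous (distFun (law P (M.lik P)))) (hX : Measurable X)
    (hc : 0 < distFun (law P X) c) (hgain : ∫⁻ ω, gain (M.marginal P X) c (X ω) ∂P ≠ ⊤)
    (hY : Y ∈ M.payoffs) (h : IntegralOrder SSD (law P Y) (law P' Y)) :
    expectedUtility (M.utility P X c) P Y ≤ expectedUtility (M.utility P X c) P' Y := by
  have := M.isProb P hP
  have := M.isProb P' hP'
  have hYm := (mem_payoffs_iff.1 hY).1
  have := isProbabilityMeasure_law (P := P) hYm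
  have := isProbabilityMeasure_law (P := P') hYm
  by_cases hl : ∫⁻ ω, loss (M.marginal P X) c (Y ω) ∂P = ⊤
  · exact (expectedUtility_eq_bot_iff.2 hl).trans_le bot_le
  have hl' := ne_top_of_le_ne_top hl (lintegral_loss_le_of_integralOrder hP hP' hYm h)
  by_cases hg' : ∫⁻ ω, gain (M.marginal P X) c (Y ω) ∂P' = ⊤
  · exact le_top.trans_eq ((expectedUtility_eq_top_iff hl').2 hg').symm
  have hg := lintegral_gain_payoff_ne_top hP hcont hX hgain hY
  rw [expectedUtility_le_iff hl']
  simp only [← lintegral_law hYm (measurable_gain _ c), ← lintegral_law hYm (measurable_loss _ c)]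
    at hg hg' ⊢
  exact lintegral_gain_add_loss_le h (antitone_marginal P X) (marginal_ne_top hc) hg hg'

theorem expectedUtility_le_of_price_le (hP : P ∈ M.models)
    (hcont : Continuous (distFun (law P (M.lik P)))) (hX : X ∈ M.payoffs)
    (hc : 0 < distFun (law P X) c) (hgain : ∫⁻ ω, gain (M.marginal P X) c (X ω) ∂P ≠ ⊤)
    (hY : Y ∈ M.payoffs) (hprice : M.price Y ≤ M.price (M.efficient P X)) :
    expectedUtility (M.utility P X c) P Y ≤ expectedUtility (M.utility P X c) P X := by
  have hXm := (mem_payoffs_iff.1 hX).1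
  have hE := efficient_mem_payoffs hP hcont hX hc hgain
  rw [expectedUtility_le_iff (lintegral_loss_self_ne_top hP hcont hXm c),
    ← lintegral_comp_efficient hP hcont hXm (measurable_gain _ c),
    ← lintegral_comp_efficient hP hcont hXm (measurable_loss _ c)]
  exact lintegral_gain_add_loss_le_of_cost_le (measurable_statePrice P) (mem_payoffs_iff.1 hY).1
    (measurable_efficient P X) (ae_isSupergradient_statePrice hP hcont hXm)
    ((mem_payoffs_iff_lintegral_statePrice_mul hP).1 hE).2 ((price_le_iff hP hY hE).1 hprice)

theorem ae_eq_efficient_of_expectedUtility_le (hP : P ∈ M.models)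
    (hcont : Continuous (distFun (law P (M.lik P)))) (hX : X ∈ M.payoffs)
    (hc : 0 < distFun (law P X) c) (hgain : ∫⁻ ω, gain (M.marginal P X) c (X ω) ∂P ≠ ⊤)
    (hY : Y ∈ M.payoffs) (hprice : M.price Y ≤ M.price (M.efficient P X))
    (hle : expectedUtility (M.utility P X c) P X ≤ expectedUtility (M.utility P X c) P Y) :
    Y =ᵐ[P] M.efficient P X := by
  have hXl := lintegral_loss_self_ne_top hP hcont (mem_payoffs_iff.1 hX).1 c
  have hYl := expectedUtility_eq_bot_iff.not.1
    (ne_bot_of_le_ne_bot (expectedUtility_eq_bot_iff.not.2 hXl) hle)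
  exact ae_eq_efficient_of_price_le hP hcont hX hc hgain hY hprice
    ((expectedUtility_le_iff hYl).1 hle)

theorem mem_budget_expectedUtility_iff {x₀ : ℝ} :
    Y ∈ M.budget (expectedUtility (M.utility P X c) P') x₀ ↔
      Y ∈ M.payoffs ∧ ∫⁻ ω, loss (M.marginal P X) c (Y ω) ∂P' ≠ ⊤ ∧
        ∫⁻ ω, gain (M.marginal P X) c (Y ω) ∂P' ≠ ⊤ ∧ M.price Y ≤ x₀ := by
  rw [budget, Set.mem_ofPred_eq, ne_eq, expectedUtility_eq_bot_iff]
  exact and_congr_right fun _ => and_congr_right fun hloss =>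
    and_congr_left' (expectedUtility_eq_top_iff hloss).not

end ExpectedUtility

/-! ### Least favorable measures -/

section LeastFavorable

variable {Ω : Type*} [MeasurableSpace Ω] {M : Market Ω} {P P' : Measure Ω} {X Y : Ω → ℝ≥0}
  {c : ℝ≥0} {𝔽 : Set (ℝ≥0 → ℝ)}

theorem integralOrder_efficient_of_leastFavorable_FSD (hP : M.LeastFavorable FSD P)
    (hcont : Continuous (distFun (law P (M.lik P)))) (hX : Measurable X) (hP' : P' ∈ M.models) :
    IntegralOrder FSD (law P X) (law P' (M.efficient P X)) := by
  have := M.isProb P hP.1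
  have := M.isProb P' hP'
  have hIoo := ae_distFun_law_mem_Ioo (measurable_lik P) hcont
  rw [← law_efficient hP.1 hcont hX]
  exact (hP.2 P' hP').law_comp_of_monotoneOn (measurable_lik P) (measurable_lik P)
    ((distFun_mono _).measurable.comp measurable_subtype_coe measurableSet_Ioo) hIoo
    ((absolutelyContinuous_of_mem_models hP' hP.1).ae_le hIoo) (measurable_transport _ _)
    (monotoneOn_transport _ _)

theorem integralOrder_efficient_of_compatible (hFSD : 𝔽 ⊆ FSD)
    (hcomp : CompositionConsistent 𝔽) (hP : M.LeastFavorable 𝔽 P)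
    (hcont : Continuous (distFun (law P (M.lik P)))) (hX : Measurable X)
    (h : M.Compatible 𝔽 P X) (hP' : P' ∈ M.models) :
    IntegralOrder 𝔽 (law P X) (law P' (M.efficient P X)) := by
  have := M.isProb P hP.1
  obtain ⟨-, g, hg, hgq⟩ := h
  have hgE : (fun ω => g (M.lik P ω)) =ᵐ[P] M.efficient P X := by
    filter_upwards [ae_distFun_law_mem_Ioo (measurable_lik P) hcont] with ω hω
    rw [efficient, ← ENNReal.coe_inj, coe_transport hω.2, hgq _ hω.1 hω.2]
  have hmono : Monotone g := fun x y hxy => NNReal.coe_le_coe.1 (hFSD hg hxy)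
  rw [← law_efficient hP.1 hcont hX, ← law_congr hgE,
    ← law_congr ((absolutelyContinuous_of_mem_models hP' hP.1).ae_eq hgE)]
  exact (hP.2 P' hP').law_comp hFSD (measurable_lik P) (measurable_lik P)
    hmono.measurable (fun f hf => hcomp f hf g hg) hFSD

theorem ae_eq_efficient_of_compatible (hFSD : 𝔽 ⊆ FSD) (hP : P ∈ M.models)
    (hcont : Continuous (distFun (law P (M.lik P)))) (hX : Measurable X)
    (h : M.Compatible 𝔽 P X) : X =ᵐ[P] M.efficient P X := by
  obtain ⟨⟨f, hf, hXf⟩, -⟩ := h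
  refine (nondecreasingInLik_iff hP hcont hX).1
    ⟨{ω | (X ω : ℝ) = f (M.lik P ω)}, hXf, fun ω hω ω' hω' hle => ?_⟩
  rw [← NNReal.coe_le_coe, show (X ω : ℝ) = _ from hω, show (X ω' : ℝ) = _ from hω']
  exact hFSD hf hle

theorem exists_mem_robustBudget_expectedUtility_lt_worstCase (hP : P ∈ M.models)
    (hcont : Continuous (distFun (law P (M.lik P)))) (hX : X ∈ M.payoffs)
    (hc : 0 < distFun (law P X) c) (hgain : ∫⁻ ω, gain (M.marginal P X) c (X ω) ∂P ≠ ⊤)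
    (horder : ∀ P' ∈ M.models, IntegralOrder FSD (law P X) (law P' (M.efficient P X)))
    (hne : ¬ X =ᵐ[P] M.efficient P X) :
    ∃ Z ∈ M.robustBudget (expectedUtility (M.utility P X c)) (M.price X),
      expectedUtility (M.utility P X c) P X
        < M.worstCase (expectedUtility (M.utility P X c)) Z := by
  have hXm := (mem_payoffs_iff.1 hX).1
  obtain ⟨φ, hφ, ⟨b, hb⟩, hZ, hprice, hlt⟩ :=
    exists_monotone_comp_efficient_gain_add_loss_lt hP hcont hX hc hgain hne
  have hZorder : ∀ P' ∈ M.models, IntegralOrder SSD (law P fun ω => φ (M.efficient P X ω))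
      (law P' fun ω => φ (M.efficient P X ω)) := fun P' hP' =>
    have hEorder := horder P' hP'
    IntegralOrder.law_comp (𝔽 := FSD) subset_rfl (measurable_efficient P X)
      (measurable_efficient P X) hφ.measurable (fun f hf => (hf.1.comp hφ : Monotone _))
      (fun f hf => hf.1) (by rwa [law_efficient hP hcont hXm])
  have hZgain : ∀ P' ∈ M.models,
      ∫⁻ ω, gain (M.marginal P X) c (φ (M.efficient P X ω)) ∂P' ≠ ⊤ := fun P' hP' =>
    have := M.isProb P' hP'
    ne_top_of_le_ne_top (by
      rw [lintegral_const, measure_univ, mul_one]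
      exact gain_ne_top (antitone_marginal P X) (marginal_ne_top hc) b)
      (lintegral_mono fun ω => gain_mono _ c (hb _))
  have hZloss : ∫⁻ ω, loss (M.marginal P X) c (φ (M.efficient P X ω)) ∂P ≠ ⊤ :=
    ne_top_of_le_ne_top (ENNReal.add_ne_top.2
      ⟨hZgain P hP, lintegral_loss_self_ne_top hP hcont hXm c⟩) (le_add_self.trans hlt.le)
  refine ⟨_, fun P' hP' => mem_budget_expectedUtility_iff.2 ⟨hZ, ne_top_of_le_ne_top hZloss
    (lintegral_loss_le_of_integralOrder hP hP' (mem_payoffs_iff.1 hZ).1 (hZorder P' hP')),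
    hZgain P' hP', hprice⟩, lt_of_lt_of_le ?_ (le_iInf₂ fun P' hP' =>
    expectedUtility_le_of_integralOrder hP hP' hcont hXm hc hgain hZ (hZorder P' hP'))⟩
  rwa [← not_le, expectedUtility_le_iff (lintegral_loss_self_ne_top hP hcont hXm c), not_le]

end LeastFavorable

end Market

/-! ### Portfolio choice and preferences -/

/-- A strictly increasing map of the extended reals into the reals, which turns extended-real-valued
functionals into real-valued ones that rank payoffs in the same way. -/
noncomputable def squash (x : EReal) : ℝ :=
  if x = ⊥ then -(Real.pi / 2) else if x = ⊤ then Real.pi / 2 else Real.arctan x.toReal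

theorem squash_strictMono : StrictMono squash := by
  intro x y h
  induction x with
  | bot =>
    induction y with
    | bot => exact absurd h (lt_irrefl _)
    | top => simpa [squash] using neg_lt_self Real.pi_div_two_pos
    | coe y => simpa [squash] using Real.neg_pi_div_two_lt_arctan y
  | top => exact absurd h not_top_lt
  | coe x =>
    induction y with
    | bot => exact absurd h not_lt_bot
    | top => simpa [squash] using Real.arctan_lt_pi_div_two x
    | coe y => simpa [squash] using Real.arctan_strictMono (EReal.coe_lt_coe_iff.1 h)

namespace Market

section Preferences

variable {Ω : Type*} [MeasurableSpace Ω] {M : Market Ω} {P : Measure Ω} {X Y : Ω → ℝ≥0}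
  {c : ℝ≥0} {x₀ : ℝ} {𝔽 : Set (ℝ≥0 → ℝ)} {V : Measure Ω → (Ω → ℝ≥0) → EReal}

theorem worstCase_le (hP : P ∈ M.models) (Y : Ω → ℝ≥0) : M.worstCase V Y ≤ V P Y :=
  iInf₂_le P hP

theorem mem_robustBudget_ofReal (W : Measure Ω → (Ω → ℝ≥0) → ℝ) (hY : Y ∈ M.payoffs)
    (hprice : M.price Y ≤ x₀) : Y ∈ M.robustBudget (ofReal W) x₀ :=
  fun _ _ => ⟨hY, EReal.coe_ne_bot _, EReal.coe_ne_top _, hprice⟩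

theorem isSolution_worstCase (hP : P ∈ M.models)
    (hsol : IsSolution (M.budget (V P) x₀) (V P) X) (hX : X ∈ M.robustBudget V x₀)
    (hle : ∀ P' ∈ M.models, V P X ≤ V P' X) :
    IsSolution (M.robustBudget V x₀) (M.worstCase V) X :=
  ⟨hX, fun Y hY => (worstCase_le hP Y).trans ((hsol.2 Y (hY P hP)).trans (le_iInf₂ hle))⟩

theorem onlySolution_worstCase (hP : P ∈ M.models)
    (hsol : IsSolution (M.budget (V P) x₀) (V P) X)
    (huniq : OnlySolution P (M.budget (V P) x₀) (V P) X) (hX : X ∈ M.robustBudget V x₀)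
    (hle : ∀ P' ∈ M.models, V P X ≤ V P' X) :
    OnlySolution P (M.robustBudget V x₀) (M.worstCase V) X := fun Y hY =>
  huniq Y ⟨hY.1 P hP, fun Z hZ => (hsol.2 Z hZ).trans
    ((le_iInf₂ hle).trans ((hY.2 X hX).trans (worstCase_le hP Y)))⟩

theorem isSolution_expectedUtility_iff (hP : P ∈ M.models)
    (hcont : Continuous (distFun (law P (M.lik P)))) (hX : X ∈ M.payoffs)
    (hc : 0 < distFun (law P X) c) (hgain : ∫⁻ ω, gain (M.marginal P X) c (X ω) ∂P ≠ ⊤)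
    (horder : ∀ P' ∈ M.models, IntegralOrder 𝔽 (law P X) (law P' (M.efficient P X)))
    (hab : 𝔽 = FSD ∨ X =ᵐ[P] M.efficient P X) :
    IsSolution (M.budget (expectedUtility (M.utility P X c) P) (M.price X))
      (expectedUtility (M.utility P X c) P) X ↔ X =ᵐ[P] M.efficient P X := by
  refine ⟨fun h => ?_, fun h => ⟨?_, fun Y hY => ?_⟩⟩
  · rcases hab with rfl | hXE
    · by_contra hne
      obtain ⟨Z, hZ, hlt⟩ :=
        exists_mem_robustBudget_expectedUtility_lt_worstCase hP hcont hX hc hgain horder hne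
      exact (h.2 Z (hZ P hP)).not_gt (hlt.trans_le (worstCase_le hP Z))
    · exact hXE
  · exact mem_budget_expectedUtility_iff.2
      ⟨hX, lintegral_loss_self_ne_top hP hcont (mem_payoffs_iff.1 hX).1 c, hgain, le_rfl⟩
  · exact expectedUtility_le_of_price_le hP hcont hX hc hgain hY.1
      (hY.2.2.2.trans_eq (price_congr hP h))

theorem onlySolution_expectedUtility (hP : P ∈ M.models)
    (hcont : Continuous (distFun (law P (M.lik P)))) (hX : X ∈ M.payoffs)
    (hc : 0 < distFun (law P X) c) (hgain : ∫⁻ ω, gain (M.marginal P X) c (X ω) ∂P ≠ ⊤)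
    (hXE : X =ᵐ[P] M.efficient P X) :
    OnlySolution P (M.budget (expectedUtility (M.utility P X c) P) (M.price X))
      (expectedUtility (M.utility P X c) P) X := fun _ hY =>
  (ae_eq_efficient_of_expectedUtility_le hP hcont hX hc hgain hY.1.1
    (hY.1.2.2.2.trans_eq (price_congr hP hXE)) (hY.2 X (mem_budget_expectedUtility_iff.2
      ⟨hX, lintegral_loss_self_ne_top hP hcont (mem_payoffs_iff.1 hX).1 c, hgain, le_rfl⟩))).trans
    hXE.symm

theorem integralOrder_law_self_of_ae_eq_efficient (hP : P ∈ M.models)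
    (horder : ∀ P' ∈ M.models, IntegralOrder 𝔽 (law P X) (law P' (M.efficient P X)))
    (hXE : X =ᵐ[P] M.efficient P X) :
    ∀ P' ∈ M.models, IntegralOrder 𝔽 (law P X) (law P' X) := fun P' hP' => by
  rw [law_congr ((absolutelyContinuous_of_mem_models hP' hP).ae_eq hXE)]
  exact horder P' hP'

theorem mem_robustBudget_expectedUtility (hP : P ∈ M.models)
    (hcont : Continuous (distFun (law P (M.lik P)))) (hX : X ∈ M.payoffs)
    (hfin : ∀ P' ∈ M.models, expectedUtility (M.utility P X c) P' X < ⊤)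
    (h : ∀ P' ∈ M.models, IntegralOrder SSD (law P X) (law P' X)) :
    X ∈ M.robustBudget (expectedUtility (M.utility P X c)) (M.price X) := fun P' hP' =>
  have hXm := (mem_payoffs_iff.1 hX).1
  have hloss := ne_top_of_le_ne_top (lintegral_loss_self_ne_top hP hcont hXm c)
    (lintegral_loss_le_of_integralOrder hP hP' hXm (h P' hP'))
  mem_budget_expectedUtility_iff.2
    ⟨hX, hloss, (expectedUtility_eq_top_iff hloss).not.1 (hfin P' hP').ne, le_rfl⟩

theorem isSolution_worstCase_expectedUtility_iff (hP : P ∈ M.models)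
    (hcont : Continuous (distFun (law P (M.lik P)))) (hX : X ∈ M.payoffs)
    (hc : 0 < distFun (law P X) c)
    (hfin : ∀ P' ∈ M.models, expectedUtility (M.utility P X c) P' X < ⊤) (hSSD : SSD ⊆ 𝔽)
    (hgain : ∫⁻ ω, gain (M.marginal P X) c (X ω) ∂P ≠ ⊤)
    (horder : ∀ P' ∈ M.models, IntegralOrder 𝔽 (law P X) (law P' (M.efficient P X)))
    (hab : 𝔽 = FSD ∨ X =ᵐ[P] M.efficient P X) :
    IsSolution (M.robustBudget (expectedUtility (M.utility P X c)) (M.price X))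
        (M.worstCase (expectedUtility (M.utility P X c))) X ∧
      (𝔽 = FSD → OnlySolution P
        (M.robustBudget (expectedUtility (M.utility P X c)) (M.price X))
        (M.worstCase (expectedUtility (M.utility P X c))) X) ↔ X =ᵐ[P] M.efficient P X := by
  refine ⟨fun h => ?_, fun hXE => ?_⟩
  · rcases hab with rfl | hXE
    · by_contra hne
      obtain ⟨Z, hZ, hlt⟩ :=
        exists_mem_robustBudget_expectedUtility_lt_worstCase hP hcont hX hc hgain horder hne
      exact ((hlt.trans_le (h.1.2 Z hZ)).trans_le (worstCase_le hP X)).false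
    · exact hXE
  · have hself := integralOrder_law_self_of_ae_eq_efficient hP horder hXE
    have hmem := mem_robustBudget_expectedUtility hP hcont hX hfin
      fun P' hP' => (hself P' hP').mono hSSD
    have hle := fun P' hP' => expectedUtility_le_of_integralOrder hP hP' hcont
      (mem_payoffs_iff.1 hX).1 hc hgain hX ((hself P' hP').mono hSSD)
    have hsol := (isSolution_expectedUtility_iff hP hcont hX hc hgain horder hab).2 hXE
    exact ⟨isSolution_worstCase hP hsol hmem hle, fun _ => onlySolution_worstCase hP hsol
      (onlySolution_expectedUtility hP hcont hX hc hgain hXE) hmem hle⟩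

end Preferences

section UtilityPreference

variable {Ω : Type*} [MeasurableSpace Ω] {M : Market Ω} {P : Measure Ω} {X : Ω → ℝ≥0}
  {c : ℝ≥0} {x₀ : ℝ} {𝔽 : Set (ℝ≥0 → ℝ)}

/-- The family of real-valued preferences that ranks payoffs by expected utility with respect to
`M.utility P X c`, also where that expected utility is infinite. -/
noncomputable def utilityPreference (M : Market Ω) (P : Measure Ω) (X : Ω → ℝ≥0) (c : ℝ≥0)
    (P' : Measure Ω) (Y : Ω → ℝ≥0) : ℝ :=
  squash (expectedUtility (M.utility P X c) P' Y)

theorem utilityPreference_le_iff {P₁ P₂ : Measure Ω} {Y₁ Y₂ : Ω → ℝ≥0} :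
    ofReal (M.utilityPreference P X c) P₁ Y₁ ≤ ofReal (M.utilityPreference P X c) P₂ Y₂ ↔
      expectedUtility (M.utility P X c) P₁ Y₁ ≤ expectedUtility (M.utility P X c) P₂ Y₂ :=
  EReal.coe_le_coe_iff.trans squash_strictMono.le_iff_le

theorem lawInvariant_utilityPreference :
    M.LawInvariant (ofReal (M.utilityPreference P X c)) := fun _ _ Y hY Z hZ h => by
  simp only [ofReal, utilityPreference,
    expectedUtility_congr_law (mem_payoffs_iff.1 hY).1 (mem_payoffs_iff.1 hZ).1 h]

theorem familyConsistent_utilityPreference (hP : P ∈ M.models)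
    (hcont : Continuous (distFun (law P (M.lik P)))) (hX : Measurable X)
    (hc : 0 < distFun (law P X) c) (hgain : ∫⁻ ω, gain (M.marginal P X) c (X ω) ∂P ≠ ⊤)
    (hSSD : SSD ⊆ 𝔽) :
    M.FamilyConsistent 𝔽 (M.robustBudget (ofReal (M.utilityPreference P X c)) x₀) P
      (ofReal (M.utilityPreference P X c)) := fun _ hY h P' hP' =>
  utilityPreference_le_iff.2 (expectedUtility_le_of_integralOrder hP hP' hcont hX hc hgain
    (hY P hP).1 ((h P' hP').mono hSSD))

theorem isSolution_utilityPreference (hP : P ∈ M.models)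
    (hcont : Continuous (distFun (law P (M.lik P)))) (hX : X ∈ M.payoffs)
    (hc : 0 < distFun (law P X) c) (hgain : ∫⁻ ω, gain (M.marginal P X) c (X ω) ∂P ≠ ⊤)
    (hXE : X =ᵐ[P] M.efficient P X) :
    IsSolution (M.budget (ofReal (M.utilityPreference P X c) P) (M.price X))
      (ofReal (M.utilityPreference P X c) P) X :=
  ⟨mem_robustBudget_ofReal _ hX le_rfl P hP, fun _ hY => utilityPreference_le_iff.2
    (expectedUtility_le_of_price_le hP hcont hX hc hgain hY.1
      (hY.2.2.2.trans_eq (price_congr hP hXE)))⟩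

theorem onlySolution_utilityPreference (hP : P ∈ M.models)
    (hcont : Continuous (distFun (law P (M.lik P)))) (hX : X ∈ M.payoffs)
    (hc : 0 < distFun (law P X) c) (hgain : ∫⁻ ω, gain (M.marginal P X) c (X ω) ∂P ≠ ⊤)
    (hXE : X =ᵐ[P] M.efficient P X) :
    OnlySolution P (M.budget (ofReal (M.utilityPreference P X c) P) (M.price X))
      (ofReal (M.utilityPreference P X c) P) X := fun _ hY =>
  (ae_eq_efficient_of_expectedUtility_le hP hcont hX hc hgain hY.1.1
    (hY.1.2.2.2.trans_eq (price_congr hP hXE)) (utilityPreference_le_iff.1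
      (hY.2 X (mem_robustBudget_ofReal _ hX le_rfl P hP)))).trans hXE.symm

end UtilityPreference

section LawInvariant

variable {Ω : Type*} [MeasurableSpace Ω] {M : Market Ω} {P : Measure Ω} {X : Ω → ℝ≥0}
  {c : ℝ≥0} {𝔽 : Set (ℝ≥0 → ℝ)} {W : Measure Ω → (Ω → ℝ≥0) → ℝ}

theorem efficient_mem_robustBudget_ofReal (W : Measure Ω → (Ω → ℝ≥0) → ℝ) (hP : P ∈ M.models)
    (hcont : Continuous (distFun (law P (M.lik P)))) (hX : X ∈ M.payoffs)
    (hc : 0 < distFun (law P X) c) (hgain : ∫⁻ ω, gain (M.marginal P X) c (X ω) ∂P ≠ ⊤) :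
    M.efficient P X ∈ M.robustBudget (ofReal W) (M.price X) :=
  mem_robustBudget_ofReal W (efficient_mem_payoffs hP hcont hX hc hgain)
    (price_efficient_le hP hcont hX hc hgain hX fun _ _ _ _ => le_rfl)

theorem LawInvariant.efficient_eq (hW : M.LawInvariant (ofReal W)) (hP : P ∈ M.models)
    (hcont : Continuous (distFun (law P (M.lik P)))) (hX : X ∈ M.payoffs)
    (hc : 0 < distFun (law P X) c) (hgain : ∫⁻ ω, gain (M.marginal P X) c (X ω) ∂P ≠ ⊤) :
    ofReal W P (M.efficient P X) = ofReal W P X :=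
  hW P hP _ (efficient_mem_payoffs hP hcont hX hc hgain) X hX
    (law_efficient hP hcont (mem_payoffs_iff.1 hX).1)

theorem LawInvariant.isSolution_efficient (hW : M.LawInvariant (ofReal W)) (hP : P ∈ M.models)
    (hcont : Continuous (distFun (law P (M.lik P)))) (hX : X ∈ M.payoffs)
    (hc : 0 < distFun (law P X) c) (hgain : ∫⁻ ω, gain (M.marginal P X) c (X ω) ∂P ≠ ⊤)
    (hsol : IsSolution (M.budget (ofReal W P) (M.price X)) (ofReal W P) X) :
    IsSolution (M.budget (ofReal W P) (M.price X)) (ofReal W P) (M.efficient P X) :=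
  ⟨efficient_mem_robustBudget_ofReal W hP hcont hX hc hgain P hP, fun Y hY =>
    (hsol.2 Y hY).trans_eq (hW.efficient_eq hP hcont hX hc hgain).symm⟩

theorem LawInvariant.isSolution_worstCase_efficient (hW : M.LawInvariant (ofReal W))
    (hcons : M.FamilyConsistent 𝔽 (M.robustBudget (ofReal W) (M.price X)) P (ofReal W))
    (hP : P ∈ M.models) (hcont : Continuous (distFun (law P (M.lik P)))) (hX : X ∈ M.payoffs)
    (hc : 0 < distFun (law P X) c) (hgain : ∫⁻ ω, gain (M.marginal P X) c (X ω) ∂P ≠ ⊤)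
    (horder : ∀ P' ∈ M.models, IntegralOrder 𝔽 (law P X) (law P' (M.efficient P X)))
    (hsol : IsSolution (M.robustBudget (ofReal W) (M.price X)) (M.worstCase (ofReal W)) X) :
    IsSolution (M.robustBudget (ofReal W) (M.price X)) (M.worstCase (ofReal W))
      (M.efficient P X) := by
  have hE := efficient_mem_robustBudget_ofReal W hP hcont hX hc hgain
  refine ⟨hE, fun Y hY => ?_⟩
  calc M.worstCase (ofReal W) Y ≤ M.worstCase (ofReal W) X := hsol.2 Y hY
    _ ≤ ofReal W P X := worstCase_le hP X
    _ = ofReal W P (M.efficient P X) := (hW.efficient_eq hP hcont hX hc hgain).symm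
    _ ≤ M.worstCase (ofReal W) (M.efficient P X) := le_iInf₂ <| hcons _ hE fun P' hP' => by
      rw [law_efficient hP hcont (mem_payoffs_iff.1 hX).1]
      exact horder P' hP'

theorem exists_familyConsistent_isSolution_iff (hP : P ∈ M.models)
    (hcont : Continuous (distFun (law P (M.lik P)))) (hX : X ∈ M.payoffs)
    (hc : 0 < distFun (law P X) c) (hgain : ∫⁻ ω, gain (M.marginal P X) c (X ω) ∂P ≠ ⊤)
    (hSSD : SSD ⊆ 𝔽) (hab : 𝔽 = FSD ∨ X =ᵐ[P] M.efficient P X) :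
    (∃ W : Measure Ω → (Ω → ℝ≥0) → ℝ,
      M.FamilyConsistent 𝔽 (M.robustBudget (ofReal W) (M.price X)) P (ofReal W) ∧
      X ∈ M.robustBudget (ofReal W) (M.price X) ∧
      IsSolution (M.budget (ofReal W P) (M.price X)) (ofReal W P) X ∧
      (𝔽 = FSD → OnlySolution P (M.budget (ofReal W P) (M.price X)) (ofReal W P) X ∧
        M.LawInvariant (ofReal W))) ↔ X =ᵐ[P] M.efficient P X := by
  constructor
  · rintro ⟨W, -, -, hsol, huniq⟩
    refine hab.elim (fun h => ?_) id
    obtain ⟨honly, hW⟩ := huniq h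
    exact (honly _ (hW.isSolution_efficient hP hcont hX hc hgain hsol)).symm
  · exact fun hXE => ⟨M.utilityPreference P X c,
      familyConsistent_utilityPreference hP hcont (mem_payoffs_iff.1 hX).1 hc hgain hSSD,
      mem_robustBudget_ofReal _ hX le_rfl,
      isSolution_utilityPreference hP hcont hX hc hgain hXE,
      fun _ => ⟨onlySolution_utilityPreference hP hcont hX hc hgain hXE,
        lawInvariant_utilityPreference⟩⟩

theorem exists_familyConsistent_isSolution_worstCase_iff (hP : P ∈ M.models)
    (hcont : Continuous (distFun (law P (M.lik P)))) (hX : X ∈ M.payoffs)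
    (hc : 0 < distFun (law P X) c) (hgain : ∫⁻ ω, gain (M.marginal P X) c (X ω) ∂P ≠ ⊤)
    (hSSD : SSD ⊆ 𝔽)
    (horder : ∀ P' ∈ M.models, IntegralOrder 𝔽 (law P X) (law P' (M.efficient P X)))
    (hab : 𝔽 = FSD ∨ X =ᵐ[P] M.efficient P X) :
    (∃ W : Measure Ω → (Ω → ℝ≥0) → ℝ,
      M.FamilyConsistent 𝔽 (M.robustBudget (ofReal W) (M.price X)) P (ofReal W) ∧
      IsSolution (M.robustBudget (ofReal W) (M.price X)) (M.worstCase (ofReal W)) X ∧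
      (𝔽 = FSD →
        OnlySolution P (M.robustBudget (ofReal W) (M.price X)) (M.worstCase (ofReal W)) X ∧
        M.LawInvariant (ofReal W))) ↔ X =ᵐ[P] M.efficient P X := by
  constructor
  · rintro ⟨W, hcons, hsol, huniq⟩
    refine hab.elim (fun h => ?_) id
    obtain ⟨honly, hW⟩ := huniq h
    exact (honly _
      (hW.isSolution_worstCase_efficient hcons hP hcont hX hc hgain horder hsol)).symm
  · intro hXE
    have hcons := familyConsistent_utilityPreference (x₀ := M.price X) hP hcont
      (mem_payoffs_iff.1 hX).1 hc hgain hSSD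
    have hmem := mem_robustBudget_ofReal (M.utilityPreference P X c) hX le_rfl
    have hsol := isSolution_utilityPreference hP hcont hX hc hgain hXE
    have hle := hcons X hmem (integralOrder_law_self_of_ae_eq_efficient hP horder hXE)
    exact ⟨_, hcons, isSolution_worstCase hP hsol hmem hle, fun _ =>
      ⟨onlySolution_worstCase hP hsol
        (onlySolution_utilityPreference hP hcont hX hc hgain hXE) hmem hle,
        lawInvariant_utilityPreference⟩⟩

end LawInvariant

end Market

end RobustCE

open RobustCE RobustCE.Market in
theorem theorem5_general {Ω : Type*} [MeasurableSpace Ω] (M : RobustCE.Market Ω)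
    (𝔽 : Set (ℝ≥0 → ℝ)) (hSSD : RobustCE.SSD ⊆ 𝔽) (hFSD : 𝔽 ⊆ RobustCE.FSD)
    (hcomp : RobustCE.CompositionConsistent 𝔽)
    (Pst : Measure Ω) (hPst : M.LeastFavorable 𝔽 Pst)
    (hcont : Continuous (RobustCE.distFun (RobustCE.law Pst (M.lik Pst))))
    (Xst : Ω → ℝ≥0) (hX : Xst ∈ M.payoffs)
    (x₀ : ℝ) (hx₀ : x₀ = M.price Xst)
    (c : ℝ≥0) (hFc : 0 < RobustCE.distFun (RobustCE.law Pst Xst) c)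
    (u : ℝ≥0 → EReal) (hu : u = M.utility Pst Xst c)
    (hfin : ∀ P ∈ M.models, RobustCE.expectedUtility u P Xst < ⊤)
    (hab : 𝔽 = RobustCE.FSD ∨ M.Compatible 𝔽 Pst Xst) :
    List.TFAE [
      M.CostEfficient Pst Xst,
      ∀ᵐ ω ∂Pst, (Xst ω : ℝ≥0∞) = RobustCE.quantile (RobustCE.law Pst Xst)
        (RobustCE.distFun (RobustCE.law Pst (M.lik Pst)) (M.lik Pst ω)),
      M.NondecreasingInLik Pst Xst,
      M.RobustCostEfficient 𝔽 (RobustCE.law Pst Xst) Xst,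
      RobustCE.IsSolution (M.budget (RobustCE.expectedUtility u Pst) x₀)
        (RobustCE.expectedUtility u Pst) Xst,
      RobustCE.IsSolution (M.robustBudget (RobustCE.expectedUtility u) x₀)
          (M.worstCase (RobustCE.expectedUtility u)) Xst ∧
        (𝔽 = RobustCE.FSD →
          RobustCE.OnlySolution Pst (M.robustBudget (RobustCE.expectedUtility u) x₀)
            (M.worstCase (RobustCE.expectedUtility u)) Xst),
      ∃ W : Measure Ω → (Ω → ℝ≥0) → ℝ,
        M.FamilyConsistent 𝔽 (M.robustBudget (RobustCE.ofReal W) x₀) Pst (RobustCE.ofReal W) ∧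
        Xst ∈ M.robustBudget (RobustCE.ofReal W) x₀ ∧
        RobustCE.IsSolution (M.budget (RobustCE.ofReal W Pst) x₀) (RobustCE.ofReal W Pst) Xst ∧
        (𝔽 = RobustCE.FSD →
          RobustCE.OnlySolution Pst (M.budget (RobustCE.ofReal W Pst) x₀)
            (RobustCE.ofReal W Pst) Xst ∧
          M.LawInvariant (RobustCE.ofReal W)),
      ∃ W : Measure Ω → (Ω → ℝ≥0) → ℝ,
        M.FamilyConsistent 𝔽 (M.robustBudget (RobustCE.ofReal W) x₀) Pst (RobustCE.ofReal W) ∧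
        RobustCE.IsSolution (M.robustBudget (RobustCE.ofReal W) x₀)
          (M.worstCase (RobustCE.ofReal W)) Xst ∧
        (𝔽 = RobustCE.FSD →
          RobustCE.OnlySolution Pst (M.robustBudget (RobustCE.ofReal W) x₀)
            (M.worstCase (RobustCE.ofReal W)) Xst ∧
          M.LawInvariant (RobustCE.ofReal W))] := by
  subst hx₀ hu
  have hPm : Pst ∈ M.models := hPst.1
  have hXm : Measurable Xst := (mem_payoffs_iff.1 hX).1
  have hgain : ∫⁻ ω, gain (M.marginal Pst Xst) c (Xst ω) ∂Pst ≠ ⊤ :=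
    (expectedUtility_eq_top_iff (lintegral_loss_self_ne_top hPm hcont hXm c)).not.1
      (hfin Pst hPm).ne
  have horder : ∀ P ∈ M.models, IntegralOrder 𝔽 (law Pst Xst) (law P (M.efficient Pst Xst)) := by
    intro P hP
    rcases hab with rfl | hcompat
    · exact integralOrder_efficient_of_leastFavorable_FSD hPst hcont hXm hP
    · exact integralOrder_efficient_of_compatible hFSD hcomp hPst hcont hXm hcompat hP
  have hab' : 𝔽 = FSD ∨ Xst =ᵐ[Pst] M.efficient Pst Xst :=
    hab.imp_right (ae_eq_efficient_of_compatible hFSD hPm hcont hXm)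
  refine List.tfae_of_forall (Xst =ᵐ[Pst] M.efficient Pst Xst) _ ?_
  simp only [List.forall_mem_cons, List.not_mem_nil, false_implies, implies_true, and_true]
  exact ⟨costEfficient_iff hPm hcont hX hFc hgain, ae_eq_quantile_iff hPm hcont Xst,
    nondecreasingInLik_iff hPm hcont hXm,
    robustCostEfficient_iff hPm hcont hX hFc hgain hSSD horder,
    isSolution_expectedUtility_iff hPm hcont hX hFc hgain horder hab',
    isSolution_worstCase_expectedUtility_iff hPm hcont hX hFc hfin hSSD hgain horder hab',
    exists_familyConsistent_isSolution_iff hPm hcont hX hFc hgain hSSD hab',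
    exists_familyConsistent_isSolution_worstCase_iff hPm hcont hX hFc hgain hSSD horder hab'⟩

theorem theorem5 {Ω : Type*} [MeasurableSpace Ω] (M : RobustCE.Market Ω)
    (𝔽 : Set (ℝ≥0 → ℝ)) (hSSD : RobustCE.SSD ⊆ 𝔽) (hFSD : 𝔽 ⊆ RobustCE.FSD)
    (hcomp : RobustCE.CompositionConsistent 𝔽) (hcost : M.CostConsistent 𝔽)
    (Pst : Measure Ω) (hPst : M.LeastFavorable 𝔽 Pst) (hreg : M.RegularLikelihood Pst)
    (Xst : Ω → ℝ≥0) (hX : Xst ∈ M.payoffs)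
    (x₀ : ℝ) (hx₀ : x₀ = M.price Xst)
    (c : ℝ≥0) (hc : 0 < c) (hFc : 0 < RobustCE.distFun (RobustCE.law Pst Xst) c)
    (u : ℝ≥0 → EReal) (hu : u = M.utility Pst Xst c)
    (hfin : ∀ P ∈ M.models, RobustCE.expectedUtility u P Xst < ⊤)
    (hab : 𝔽 = RobustCE.FSD ∨ M.Compatible 𝔽 Pst Xst) :
    List.TFAE [
      M.CostEfficient Pst Xst,
      ∀ᵐ ω ∂Pst, (Xst ω : ℝ≥0∞) = RobustCE.quantile (RobustCE.law Pst Xst)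
        (RobustCE.distFun (RobustCE.law Pst (M.lik Pst)) (M.lik Pst ω)),
      M.NondecreasingInLik Pst Xst,
      M.RobustCostEfficient 𝔽 (RobustCE.law Pst Xst) Xst,
      RobustCE.IsSolution (M.budget (RobustCE.expectedUtility u Pst) x₀)
        (RobustCE.expectedUtility u Pst) Xst,
      RobustCE.IsSolution (M.robustBudget (RobustCE.expectedUtility u) x₀)
          (M.worstCase (RobustCE.expectedUtility u)) Xst ∧
        (𝔽 = RobustCE.FSD →
          RobustCE.OnlySolution Pst (M.robustBudget (RobustCE.expectedUtility u) x₀)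
            (M.worstCase (RobustCE.expectedUtility u)) Xst),
      ∃ W : Measure Ω → (Ω → ℝ≥0) → ℝ,
        M.FamilyConsistent 𝔽 (M.robustBudget (RobustCE.ofReal W) x₀) Pst (RobustCE.ofReal W) ∧
        Xst ∈ M.robustBudget (RobustCE.ofReal W) x₀ ∧
        RobustCE.IsSolution (M.budget (RobustCE.ofReal W Pst) x₀) (RobustCE.ofReal W Pst) Xst ∧
        (𝔽 = RobustCE.FSD →
          RobustCE.OnlySolution Pst (M.budget (RobustCE.ofReal W Pst) x₀)
            (RobustCE.ofReal W Pst) Xst ∧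
          M.LawInvariant (RobustCE.ofReal W)),
      ∃ W : Measure Ω → (Ω → ℝ≥0) → ℝ,
        M.FamilyConsistent 𝔽 (M.robustBudget (RobustCE.ofReal W) x₀) Pst (RobustCE.ofReal W) ∧
        RobustCE.IsSolution (M.robustBudget (RobustCE.ofReal W) x₀)
          (M.worstCase (RobustCE.ofReal W)) Xst ∧
        (𝔽 = RobustCE.FSD →
          RobustCE.OnlySolution Pst (M.robustBudget (RobustCE.ofReal W) x₀)
            (M.worstCase (RobustCE.ofReal W)) Xst ∧
          M.LawInvariant (RobustCE.ofReal W))] :=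
  theorem5_general M 𝔽 hSSD hFSD hcomp Pst hPst hreg.1 Xst hX x₀ hx₀ c hFc u hu hfin hab
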